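/- Let $\mathbb{T}^2=[0,1)^2$ be the two-dimensional torus and, for $f:\mathbb{T}^2\to\mathbb{R}$, let $\widehat f(k)=\int_{\mathbb{T}^2}e^{-ik\cdot x}f(x)\,dx$, $k\in(2\pi\mathbb{Z})^2$, with the natural extension to periodic distributions. Let $|\partial_j|^s$ be the Fourier multiplier with symbol $|k_j|^s$ (for $s<0$ acting only on the modes with $k_j\neq 0$, the other modes being set to $0$), let $R_1=|\partial_1|^{-1}\partial_1$ be the Hilbert transform in $x_1$, i.e. the multiplier with symbol $i\,\mathrm{sgn}(k_1)$, let $P$ be the $L^2$-orthogonal projection onto functions of vanishing average in $x_1$ (extended to distributions by duality), let $\mathcal{L}=-\partial_1^2-|\partial_1|^{-1}\partial_2^2$, and let $$\mathcal{H}(w)=\int_{\mathbb{T}^2}(\partial_1w)^2\,dx+\int_{\mathbb{T}^2}\big(|\partial_1|^{-\frac12}\partial_2w\big)^2\,dx\in[0,\infty].$$ Let $\mathcal{W}$ be the set of real-valued $w\in L^2(\mathbb{T}^2)$ with $\int_0^1w\,dx_1=0$ for a.e. $x_2$ and $\mathcal{H}(w)<\infty$. For real-valued $\xi\in L^2(\mathbb{T}^2)$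 consider the Euler–Lagrange equation $$\mathcal{L}u=-P\Big(uR_1\partial_2u-\tfrac12uR_1\partial_1u^2\Big)-\tfrac12R_1\partial_2u^2+P\xi .\qquad(\ast)$$ A function $u\in\mathcal{W}$ is called a finite-energy weak solution of $(\ast)$ if $(\ast)$ holds when tested with every smooth periodic $\varphi$, where the product of $u$ with a distribution $a$ is tested as $\langle ua,\psi\rangle=\langle a,u\psi\rangle=\sum_k\widehat a(k)\overline{\widehat{u\psi}(k)}$. For $i\in\{1,2\}$ and $h\in(0,1]$ let $$D_i^hf(x)=h^{-\alpha_i}\big(f(x+he_i)-f(x)\big),\qquad \alpha_1=1,\quad \alpha_2=\tfrac23 .$$ (1) ($H^{3-}$ estimate.) There exists a universal constant $C>0$ such that for every $\xi\in L^2(\mathbb{T}^2)$ with $\mathcal{H}(\xi)<\infty$, every finite-energy weak solution $u$ of $(\ast)$ and each $i\in\{1,2\}$, $$\sup_{h,h'\in(0,1]}\mathcal{H}(D_i^hD_i^{h'}u)\le C\big(1+\mathcal{H}(\xi)^{22}+\mathcal{H}(u)^{132}\big).$$ In particular $|\partial_1|^su\in L^2(\mathbb{T}^2)$ and $|\partial_2|^{\frac23s}u\in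 L^2(\mathbb{T}^2)$ for every $s\in[0,3)$. (2) ($H^{2-}$ estimate.) There exists a universal constant $C>0$ such that for every $\xi\in L^2(\mathbb{T}^2)$, every finite-energy weak solution $u$ of $(\ast)$ and each $i\in\{1,2\}$, $$\sup_{h\in(0,1]}\mathcal{H}(D_i^hu)\le C\big(1+\|\xi\|_{L^2}^2+\mathcal{H}(u)^{12}\big).$$ In particular $|\partial_1|^su\in L^2(\mathbb{T}^2)$ and $|\partial_2|^{\frac23s}u\in L^2(\mathbb{T}^2)$ for every $s\in[0,2)$. -/

import Mathlib

open MeasureTheory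
open scoped ENNReal

noncomputable section

namespace Ripple

/-- The two-dimensional torus `𝕋² = [0,1)²`. The first coordinate `x₁` is `x 0`, and the second
coordinate `x₂` is `x 1`. -/
abbrev T2 : Type := UnitAddTorus (Fin 2)

/-- Lebesgue measure on the circle `[0,1)` (the Haar probability measure). -/
abbrev circ : Measure UnitAddCircle := AddCircle.haarAddCircle

/-- Lebesgue measure on `𝕋²`. -/
abbrev leb : Measure T2 := Measure.pi fun _ => circ

/-- Families of Fourier coefficients, indexed by `n ∈ ℤ²`; the frequency is `k = 2πn`.
A periodic distribution is represented by the family of its Fourier coefficients. -/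
abbrev Coeffs : Type := (Fin 2 → ℤ) → ℂ

/-- The frequency `k = 2πn ∈ (2πℤ)²`. -/
def freq (n : Fin 2 → ℤ) (j : Fin 2) : ℝ := 2 * Real.pi * (n j : ℝ)

/-- Fourier coefficients `f̂(k) = ∫ exp(-i k·x) f(x) dx` of a real function on the torus. -/
def coeff (f : T2 → ℝ) : Coeffs :=
  fun n => UnitAddTorus.mFourierCoeff (fun x => (f x : ℂ)) n

/-- The partial derivative `∂ⱼ`, with symbol `i kⱼ`. -/
def pd (j : Fin 2) (a : Coeffs) : Coeffs :=
  fun n => Complex.I * (freq n j : ℂ) * a n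

/-- The operator `|∂ⱼ|ˢ`, with symbol `|kⱼ|ˢ`. For `s = 0` it is the identity. For `s < 0` it acts
on the modes with `kⱼ ≠ 0` only, and the modes with `kⱼ = 0` are sent to `0`. -/
def absPd (j : Fin 2) (s : ℝ) (a : Coeffs) : Coeffs :=
  fun n => ((|freq n j| ^ s : ℝ) : ℂ) * a n

/-- The Hilbert transform `R₁ = |∂₁|⁻¹ ∂₁` in `x₁`, with symbol `i sgn k₁`. -/
def hilbert1 (a : Coeffs) : Coeffs :=
  fun n => Complex.I * (SignType.sign (freq n 0) : ℝ) * a n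

/-- The operator `𝓛 = -∂₁² - |∂₁|⁻¹ ∂₂²`. -/
def opL (a : Coeffs) : Coeffs :=
  -pd 0 (pd 0 a) - absPd 0 (-1) (pd 1 (pd 1 a))

/-- The square `‖a‖²_{L²} = ∑ₖ |a(k)|²` of the `L²` norm of the distribution with Fourier
coefficients `a`; it is `∞` if that distribution is not in `L²`. -/
def l2NormSq (a : Coeffs) : ℝ≥0∞ := ∑' n, ENNReal.ofReal (‖a n‖ ^ 2)

/-- The harmonic energy `𝓗(w) = ∫ (∂₁ w)² dx + ∫ (|∂₁|^(-1/2) ∂₂ w)² dx ∈ [0,∞]`. -/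
def harmonicEnergy (w : T2 → ℝ) : ℝ≥0∞ :=
  l2NormSq (pd 0 (coeff w)) + l2NormSq (absPd 0 (-1 / 2) (pd 1 (coeff w)))

/-- `w` has vanishing average in `x₁`: `∫₀¹ w dx₁ = 0` for (almost) every `x₂`. -/
def VanishingAvg (w : T2 → ℝ) : Prop :=
  ∀ᵐ x₂ ∂circ, ∫ x₁, w ![x₁, x₂] ∂circ = 0

/-- The space `𝓦` of configurations of finite harmonic energy: `w ∈ L²(𝕋²)` with vanishing
average in `x₁` and `𝓗(w) < ∞`. -/
def MemW (w : T2 → ℝ) : Prop :=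
  MemLp w 2 leb ∧ VanishingAvg w ∧ harmonicEnergy w < ∞

/-- Test functions: smooth (periodic) real functions on the torus. -/
def IsTest (φ : T2 → ℝ) : Prop :=
  ContDiff ℝ (⊤ : ℕ∞) (fun y : Fin 2 → ℝ => φ (fun j => (y j : UnitAddCircle)))

/-- The projection `P` onto functions of vanishing average in `x₁`:
`(Pφ)(x) = φ(x) - ∫₀¹ φ(t, x₂) dt`. It is symmetric, and acts on distributions by duality. -/
def projP (φ : T2 → ℝ) : T2 → ℝ :=
  fun x => φ x - ∫ t, φ ![t, x 1] ∂circ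

/-- The pairing `∫ a g dx = ∑ₖ a(k) conj ĝ(k)` of the distribution with Fourier coefficients `a`
with a real function `g`. -/
def pairing (a : Coeffs) (g : T2 → ℝ) : ℂ := ∑' n, a n * (starRingEnd ℂ) (coeff g n)

/-- `u` is a weak (distributional) solution of the Euler-Lagrange equation
`𝓛 u = -P(u R₁∂₂u - ½ u R₁∂₁u²) - ½ R₁∂₂u² + Pξ`, i.e. the equation holds when tested with any
smooth periodic `φ`. The operator `P` is moved to the test function, and the product of `u` with
a distribution `a` is tested as `⟨u a, ψ⟩ = ⟨a, u ψ⟩`; all the series below converge absolutely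
for `u` in `𝓦` and `ξ` in `L²`. -/
def IsWeakSolution (ξ u : T2 → ℝ) : Prop :=
  ∀ φ : T2 → ℝ, IsTest φ →
    pairing (opL (coeff u)) φ =
      -(pairing (hilbert1 (pd 1 (coeff u))) (fun x => u x * projP φ x)
          - 1 / 2 * pairing (hilbert1 (pd 0 (coeff (fun x => u x ^ 2))))
              (fun x => u x * projP φ x))
        - 1 / 2 * pairing (hilbert1 (pd 1 (coeff (fun x => u x ^ 2)))) φ
        + pairing (coeff ξ) (projP φ)

/-- The exponents `α₁ = 1`, `α₂ = 2/3`. -/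
def alpha : Fin 2 → ℝ := ![1, 2 / 3]

/-- The difference quotient `Dᵢʰ f(x) = |h|^(-αᵢ) (f(x + h eᵢ) - f(x))`. -/
def diffQuot (i : Fin 2) (h : ℝ) (f : T2 → ℝ) : T2 → ℝ :=
  fun x => |h| ^ (-alpha i) * (f (x + Pi.single i (h : UnitAddCircle)) - f x)

end Ripple

end

/-!
Testing the equation with the real trigonometric monomials of frequency `k` turns it into an
inequality, mode by mode, between absolute values of Fourier coefficients: `ω(k)² |û(k)|`, with
`ω(k)² = k₁² + k₂²/|k₁|`, is bounded by convolutions of the sequence `|û|` with itself, plus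
`|ξ̂(k)|`. From here on only nonnegative sequences occur. Cauchy–Schwarz and the summability of
`ω^(-13/5)` over the modes with `k₁ ≠ 0` bound these convolutions by products of `L²` and energy
norms, and weighted `L²` norms interpolate between the two.

The symbol of a difference quotient is subadditive in the frequency, so that difference quotients
obey a Leibniz inequality for convolutions. Pairing the mode inequality with the difference quotient
of `|û|` therefore bounds its squared energy by a quantity that is subquadratic in the energy itself
and can be absorbed; a second pass, with the first bound as input, handles the iterated quotient.
Finally, a bound on difference quotients uniform in the step size controls each dyadic block of
frequencies, and the blocks are summable for every order of differentiation below the critical one.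
-/

noncomputable section

namespace Ripple

section Sequences

variable {ι : Type*}

theorem tsum_rpow_mul_rpow_le (f g : ι → ℝ≥0∞) {p q : ℝ} (hp : 0 ≤ p) (hq : 0 ≤ q)
    (hpq : p + q = 1) :
    ∑' i, f i ^ p * g i ^ q ≤ (∑' i, f i) ^ p * (∑' i, g i) ^ q := by
  let _ : MeasurableSpace ι := ⊤
  have _ : MeasurableSingletonClass ι := ⟨fun _ => trivial⟩
  simpa only [lintegral_count] using
    ENNReal.lintegral_mul_norm_pow_le (μ := Measure.count) (f := f) (g := g)
      measurable_from_top.aemeasurable measurable_from_top.aemeasurable hp hq hpq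

theorem rpow_two_inv_sq (x : ℝ≥0∞) : (x ^ (2⁻¹ : ℝ)) ^ 2 = x :=
  mod_cast ENNReal.rpow_inv_natCast_pow two_ne_zero x

theorem sq_rpow_two_inv (x : ℝ≥0∞) : (x ^ 2) ^ (2⁻¹ : ℝ) = x :=
  mod_cast ENNReal.pow_rpow_inv_natCast two_ne_zero x

theorem rpow_neg_le_rpow_neg {x y : ℝ≥0∞} {s : ℝ} (hs : 0 ≤ s) (h : x ≤ y) :
    y ^ (-s) ≤ x ^ (-s) := by
  rw [ENNReal.rpow_neg, ENNReal.rpow_neg]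
  exact ENNReal.inv_le_inv.2 (ENNReal.rpow_le_rpow h hs)

theorem sq_tsum_le_of_sq_le_mul {x p q : ι → ℝ≥0∞} (h : ∀ i, x i ^ 2 ≤ p i * q i) :
    (∑' i, x i) ^ 2 ≤ (∑' i, p i) * ∑' i, q i := by
  have hx (i : ι) : x i ≤ p i ^ (2⁻¹ : ℝ) * q i ^ (2⁻¹ : ℝ) := by
    rw [← ENNReal.mul_rpow_of_nonneg _ _ (by norm_num), ← sq_rpow_two_inv (x i)]
    gcongr
    exact h i
  calc (∑' i, x i) ^ 2
      ≤ ((∑' i, p i) ^ (2⁻¹ : ℝ) * (∑' i, q i) ^ (2⁻¹ : ℝ)) ^ 2 := by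
        gcongr
        exact (ENNReal.tsum_le_tsum hx).trans
          (tsum_rpow_mul_rpow_le p q (by norm_num) (by norm_num) (by norm_num))
    _ = _ := by rw [mul_pow, rpow_two_inv_sq, rpow_two_inv_sq]

/-- The `ℓ²` norm of a family of extended nonnegative numbers. A function on the torus enters the
estimates only through the absolute values of its Fourier coefficients. -/
def l2Norm (f : ι → ℝ≥0∞) : ℝ≥0∞ := (∑' i, f i ^ 2) ^ (2⁻¹ : ℝ)

theorem l2Norm_sq (f : ι → ℝ≥0∞) : l2Norm f ^ 2 = ∑' i, f i ^ 2 := rpow_two_inv_sq _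

theorem l2Norm_le_iff {f : ι → ℝ≥0∞} {t : ℝ≥0∞} : l2Norm f ≤ t ↔ ∑' i, f i ^ 2 ≤ t ^ 2 := by
  rw [← l2Norm_sq, ENNReal.pow_le_pow_left_iff two_ne_zero]

theorem l2Norm_mono {f g : ι → ℝ≥0∞} (h : f ≤ g) : l2Norm f ≤ l2Norm g := by
  rw [l2Norm_le_iff, l2Norm_sq]
  gcongr with i
  exact h i

theorem l2Norm_add_le (f g : ι → ℝ≥0∞) : l2Norm (f + g) ≤ l2Norm f + l2Norm g := by
  let _ : MeasurableSpace ι := ⊤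
  have _ : MeasurableSingletonClass ι := ⟨fun _ => trivial⟩
  simpa [lintegral_count, l2Norm] using
    ENNReal.lintegral_Lp_add_le (μ := Measure.count) (f := f) (g := g)
      measurable_from_top.aemeasurable measurable_from_top.aemeasurable one_le_two

theorem l2Norm_mul_le_of_le {a f : ι → ℝ≥0∞} {K : ℝ≥0∞} (h : ∀ i, a i ≤ K) :
    l2Norm (a * f) ≤ K * l2Norm f := by
  rw [l2Norm_le_iff, mul_pow, l2Norm_sq, ← ENNReal.tsum_mul_left]
  gcongr with i
  rw [Pi.mul_apply, mul_pow]
  gcongr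
  exact h i

/-- The pairing `∑ᵢ fᵢ gᵢ` of two families of extended nonnegative numbers. -/
def l2Pairing (f g : ι → ℝ≥0∞) : ℝ≥0∞ := ∑' i, f i * g i

theorem l2Pairing_mono {f g g' : ι → ℝ≥0∞} (h : g ≤ g') : l2Pairing f g ≤ l2Pairing f g' := by
  unfold l2Pairing
  gcongr with i
  exact h i

theorem l2Pairing_add_right (f g g' : ι → ℝ≥0∞) :
    l2Pairing f (g + g') = l2Pairing f g + l2Pairing f g' := by
  simp only [l2Pairing, Pi.add_apply, mul_add, ENNReal.tsum_add]

theorem l2Pairing_mul_left (f g w : ι → ℝ≥0∞) :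
    l2Pairing (w * f) g = l2Pairing f (w * g) :=
  tsum_congr fun _ => by simp only [Pi.mul_apply]; ring

theorem l2Pairing_le (f g : ι → ℝ≥0∞) : l2Pairing f g ≤ l2Norm f * l2Norm g := by
  rw [← ENNReal.pow_le_pow_left_iff two_ne_zero, mul_pow, l2Norm_sq, l2Norm_sq]
  exact sq_tsum_le_of_sq_le_mul fun i => (mul_pow _ _ 2).le

end Sequences

section Convolution

variable {G : Type*} [AddCommGroup G]

/-- The convolution of two families of extended nonnegative numbers. -/
def conv (B C : G → ℝ≥0∞) (n : G) : ℝ≥0∞ := ∑' l, B l * C (n - l)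

theorem conv_comm (B C : G → ℝ≥0∞) : conv B C = conv C B := by
  ext n
  unfold conv
  rw [← (Equiv.subLeft n).tsum_eq]
  simp only [Equiv.subLeft_apply, sub_sub_cancel, mul_comm]

theorem conv_neg {B C : G → ℝ≥0∞} (hB : ∀ n, B (-n) = B n) (hC : ∀ n, C (-n) = C n) (n : G) :
    conv B C (-n) = conv B C n := by
  unfold conv
  rw [← (Equiv.neg G).tsum_eq]
  refine tsum_congr fun l => ?_
  rw [Equiv.neg_apply, hB, ← hC (n - l), neg_sub, neg_sub_neg]

theorem tsum_conv (B C : G → ℝ≥0∞) : ∑' n, conv B C n = (∑' l, B l) * ∑' m, C m := by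
  unfold conv
  rw [ENNReal.tsum_comm, ← ENNReal.tsum_mul_right]
  refine tsum_congr fun l => ?_
  rw [ENNReal.tsum_mul_left]
  congr 1
  exact (Equiv.subRight l).tsum_eq C

theorem tsum_sq_mul_conv_le {v κ f g B C : G → ℝ≥0∞}
    (h : ∀ l m, (v (l + m) * (B l * C m)) ^ 2 ≤ (κ l + κ m) * (f l * g m)) :
    ∑' n, (v n * conv B C n) ^ 2 ≤ 2 * (∑' l, κ l) * ((∑' l, f l) * ∑' m, g m) := by
  rw [← tsum_conv, ← ENNReal.tsum_mul_left]
  gcongr with n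
  have hκ : ∑' l, (κ l + κ (n - l)) = 2 * ∑' l, κ l := by
    rw [ENNReal.tsum_add, two_mul]
    congr 1
    exact (Equiv.subLeft n).tsum_eq κ
  rw [← hκ, conv, ← ENNReal.tsum_mul_left]
  refine sq_tsum_le_of_sq_le_mul fun l => ?_
  simpa only [add_sub_cancel] using h l (n - l)

theorem l2Pairing_conv {C : G → ℝ≥0∞} (hC : ∀ n, C (-n) = C n) (F B : G → ℝ≥0∞) :
    l2Pairing F (conv B C) = l2Pairing B (conv F C) := by
  simp only [l2Pairing, conv, ← ENNReal.tsum_mul_left]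
  rw [ENNReal.tsum_comm]
  refine tsum_congr fun l => tsum_congr fun n => ?_
  rw [← hC (l - n), neg_sub]
  ring

theorem l2Pairing_conv_mul_le {C : G → ℝ≥0∞} (hC : ∀ n, C (-n) = C n) (F w B : G → ℝ≥0∞) :
    l2Pairing F (conv (w * B) C) ≤ l2Norm B * l2Norm (w * conv F C) := by
  rw [l2Pairing_conv hC, l2Pairing_mul_left]
  exact l2Pairing_le _ _

/-- An even subadditive weight on the frequencies, such as the symbol of a difference quotient. -/
structure SubadditiveWeight (a : G → ℝ≥0∞) : Prop where
  neg : ∀ n, a (-n) = a n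
  add_le : ∀ l m, a (l + m) ≤ a l + a m

/-- A weight `D` obeying a Leibniz rule in which the mixed terms involve the subadditive weights
`a` and `b`. The example in mind is the symbol `D = a b` of an iterated difference quotient. -/
structure LeibnizWeight (D a b : G → ℝ≥0∞) : Prop where
  neg : ∀ n, D (-n) = D n
  left : SubadditiveWeight a
  right : SubadditiveWeight b
  add_le : ∀ l m, D (l + m) ≤ D l + D m + a l * b m + b l * a m

theorem subadditiveWeight_zero : SubadditiveWeight (0 : G → ℝ≥0∞) := ⟨by simp, by simp⟩

theorem SubadditiveWeight.leibnizWeight {a : G → ℝ≥0∞} (ha : SubadditiveWeight a) :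
    LeibnizWeight a 0 0 where
  neg := ha.neg
  left := subadditiveWeight_zero
  right := subadditiveWeight_zero
  add_le l m := by simpa using ha.add_le l m

theorem SubadditiveWeight.leibnizWeight_mul {a b : G → ℝ≥0∞} (ha : SubadditiveWeight a)
    (hb : SubadditiveWeight b) : LeibnizWeight (a * b) a b where
  neg n := by simp only [Pi.mul_apply, ha.neg, hb.neg]
  left := ha
  right := hb
  add_le l m :=
    calc a (l + m) * b (l + m) ≤ (a l + a m) * (b l + b m) :=
          mul_le_mul' (ha.add_le l m) (hb.add_le l m)
      _ = a l * b l + a m * b m + a l * b m + b l * a m := by ring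

theorem LeibnizWeight.mul_conv_le {D a b : G → ℝ≥0∞} (hD : LeibnizWeight D a b)
    (B C : G → ℝ≥0∞) :
    D * conv B C ≤ conv (D * B) C + conv B (D * C) + conv (a * B) (b * C)
      + conv (b * B) (a * C) := by
  intro n
  simp only [Pi.add_apply, Pi.mul_apply, conv, ← ENNReal.tsum_add, ← ENNReal.tsum_mul_left]
  gcongr with l
  calc D n * (B l * C (n - l))
      ≤ (D l + D (n - l) + a l * b (n - l) + b l * a (n - l)) * (B l * C (n - l)) := by
        gcongr
        simpa only [add_sub_cancel] using hD.add_le l (n - l)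
    _ = _ := by ring

theorem LeibnizWeight.l2Pairing_mul_conv_le {D a b : G → ℝ≥0∞} (hD : LeibnizWeight D a b)
    (F w B C : G → ℝ≥0∞) :
    l2Pairing F (D * conv (w * B) C) ≤
      l2Pairing F (conv (w * (D * B)) C) + l2Pairing F (conv (w * B) (D * C))
        + l2Pairing F (conv (w * (a * B)) (b * C)) + l2Pairing F (conv (w * (b * B)) (a * C)) := by
  simp only [← l2Pairing_add_right, mul_left_comm w]
  exact l2Pairing_mono (hD.mul_conv_le (w * B) C)

theorem SubadditiveWeight.mul_conv_le {a : G → ℝ≥0∞} (ha : SubadditiveWeight a)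
    (B C : G → ℝ≥0∞) : a * conv B C ≤ conv (a * B) C + conv B (a * C) := by
  have hzero : conv (0 : G → ℝ≥0∞) 0 = 0 := by
    ext
    simp [conv]
  simpa [hzero] using ha.leibnizWeight.mul_conv_le B C

end Convolution

section Weights

theorem freq_neg (n : Fin 2 → ℤ) (j : Fin 2) : freq (-n) j = -freq n j := by simp [freq]

theorem freq_add (l m : Fin 2 → ℤ) (j : Fin 2) : freq (l + m) j = freq l j + freq m j := by
  simp [freq, mul_add]

theorem freq_eq_zero_iff {n : Fin 2 → ℤ} {j : Fin 2} : freq n j = 0 ↔ n j = 0 := by simp [freq]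

theorem enorm_intCast_le_enorm_freq (n : Fin 2 → ℤ) (j : Fin 2) :
    ‖(n j : ℝ)‖ₑ ≤ ‖freq n j‖ₑ := by
  rw [freq, enorm_mul]
  refine le_mul_of_one_le_left' ?_
  rw [Real.enorm_of_nonneg Real.two_pi_pos.le, ENNReal.one_le_ofReal]
  linarith [Real.pi_gt_three]

/-- The symbol `|k₁|^(1/2)`. -/
def halfWt (n : Fin 2 → ℤ) : ℝ≥0∞ := ‖freq n 0‖ₑ ^ (2⁻¹ : ℝ)

/-- The symbol `|k₁|^(-1/2) |k₂|` of the transversal part of the harmonic energy, which vanishes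
on the modes with `k₁ = 0`. -/
def transWt (n : Fin 2 → ℤ) : ℝ≥0∞ := ‖|freq n 0| ^ (-1 / 2 : ℝ) * freq n 1‖ₑ

/-- The symbol `ω = (k₁² + |k₁|⁻¹ k₂²)^(1/2)` of the square root of `𝓛`, which vanishes on the
modes with `k₁ = 0`. -/
def energyWt (n : Fin 2 → ℤ) : ℝ≥0∞ := (‖freq n 0‖ₑ ^ 2 + transWt n ^ 2) ^ (2⁻¹ : ℝ)

theorem halfWt_neg (n : Fin 2 → ℤ) : halfWt (-n) = halfWt n := by simp [halfWt, freq_neg]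

theorem transWt_neg (n : Fin 2 → ℤ) : transWt (-n) = transWt n := by simp [transWt, freq_neg]

theorem halfWt_sq (n : Fin 2 → ℤ) : halfWt n ^ 2 = ‖freq n 0‖ₑ := rpow_two_inv_sq _

theorem halfWt_sq_add_le (l m : Fin 2 → ℤ) : halfWt (l + m) ^ 2 ≤ halfWt l ^ 2 + halfWt m ^ 2 := by
  simpa only [halfWt_sq, freq_add] using enorm_add_le (freq l 0) (freq m 0)

theorem halfWt_mul_transWt {n : Fin 2 → ℤ} (hn : n 0 ≠ 0) :
    halfWt n * transWt n = ‖freq n 1‖ₑ := by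
  have h0 : 0 < |freq n 0| := abs_pos.2 (freq_eq_zero_iff.not.2 hn)
  have hhalf : halfWt n = ‖|freq n 0| ^ (2⁻¹ : ℝ)‖ₑ := by
    rw [Real.enorm_rpow_of_nonneg h0.le (by norm_num), Real.enorm_abs, halfWt]
  rw [hhalf, transWt, ← enorm_mul, ← mul_assoc, ← Real.rpow_add h0]
  norm_num

theorem energyWt_sq (n : Fin 2 → ℤ) : energyWt n ^ 2 = ‖freq n 0‖ₑ ^ 2 + transWt n ^ 2 :=
  rpow_two_inv_sq _

theorem enorm_freq_zero_le_energyWt (n : Fin 2 → ℤ) : ‖freq n 0‖ₑ ≤ energyWt n := by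
  rw [← ENNReal.pow_le_pow_left_iff two_ne_zero, energyWt_sq]
  exact le_self_add

theorem transWt_le_energyWt (n : Fin 2 → ℤ) : transWt n ≤ energyWt n := by
  rw [← ENNReal.pow_le_pow_left_iff two_ne_zero, energyWt_sq]
  exact le_add_self

theorem energyWt_ne_top (n : Fin 2 → ℤ) : energyWt n ≠ ⊤ :=
  ENNReal.rpow_ne_top_of_nonneg (by norm_num) (by unfold transWt; finiteness)

theorem one_le_enorm_intCast {a : ℤ} (ha : a ≠ 0) : 1 ≤ ‖(a : ℝ)‖ₑ := by
  rw [← ofReal_norm, ENNReal.one_le_ofReal, Real.norm_eq_abs]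
  exact_mod_cast Int.one_le_abs ha

theorem one_le_energyWt {n : Fin 2 → ℤ} (hn : n 0 ≠ 0) : 1 ≤ energyWt n :=
  (one_le_enorm_intCast hn).trans
    ((enorm_intCast_le_enorm_freq n 0).trans (enorm_freq_zero_le_energyWt n))

theorem energyWt_ne_zero {n : Fin 2 → ℤ} (hn : n 0 ≠ 0) : energyWt n ≠ 0 :=
  (zero_lt_one.trans_le (one_le_energyWt hn)).ne'

theorem enorm_freq_one_sq_le {n : Fin 2 → ℤ} (hn : n 0 ≠ 0) :
    ‖freq n 1‖ₑ ^ 2 ≤ energyWt n ^ 3 :=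
  calc ‖freq n 1‖ₑ ^ 2 = ‖freq n 0‖ₑ * transWt n ^ 2 := by
        rw [← halfWt_mul_transWt hn, mul_pow, halfWt_sq]
    _ ≤ energyWt n * energyWt n ^ 2 := by
        gcongr
        · exact enorm_freq_zero_le_energyWt n
        · exact transWt_le_energyWt n
    _ = energyWt n ^ 3 := by ring

theorem alpha_mem_Icc (i : Fin 2) : alpha i ∈ Set.Icc 0 1 := by
  fin_cases i <;> norm_num [alpha]

theorem enorm_freq_rpow_alpha_le_energyWt (i : Fin 2) {n : Fin 2 → ℤ} (hn : n 0 ≠ 0) :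
    ‖freq n i‖ₑ ^ alpha i ≤ energyWt n := by
  fin_cases i
  · simpa [alpha] using enorm_freq_zero_le_energyWt n
  · calc ‖freq n 1‖ₑ ^ (2 / 3 : ℝ) = (‖freq n 1‖ₑ ^ 2) ^ (1 / 3 : ℝ) := by
          rw [← ENNReal.rpow_natCast, ← ENNReal.rpow_mul]
          norm_num
      _ ≤ (energyWt n ^ 3) ^ (1 / 3 : ℝ) :=
          ENNReal.rpow_le_rpow (enorm_freq_one_sq_le hn) (by norm_num)
      _ = energyWt n := by
          rw [← ENNReal.rpow_natCast, ← ENNReal.rpow_mul]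
          norm_num

/-- The summable weight `ω^(-13/5)`, cut off on the modes with `k₁ = 0`. -/
def decayWt (n : Fin 2 → ℤ) : ℝ≥0∞ := if n 0 = 0 then 0 else energyWt n ^ (-(13 / 5) : ℝ)

theorem decayWt_le (n : Fin 2 → ℤ) :
    decayWt n ≤ max 1 ‖(n 0 : ℝ)‖ₑ ^ (-(21 / 20) : ℝ) * max 1 ‖(n 1 : ℝ)‖ₑ ^ (-(31 / 30) : ℝ) := by
  rw [decayWt]
  split_ifs with hn
  · exact zero_le
  have h0 : max 1 ‖(n 0 : ℝ)‖ₑ ≤ energyWt n :=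
    max_le (one_le_energyWt hn)
      ((enorm_intCast_le_enorm_freq n 0).trans (enorm_freq_zero_le_energyWt n))
  have h1 : max 1 ‖(n 1 : ℝ)‖ₑ ^ (2 / 3 : ℝ) ≤ energyWt n := by
    rcases max_choice 1 ‖(n 1 : ℝ)‖ₑ with h | h <;> rw [h]
    · simpa using one_le_energyWt hn
    · refine le_trans ?_ (enorm_freq_rpow_alpha_le_energyWt 1 hn)
      exact ENNReal.rpow_le_rpow (enorm_intCast_le_enorm_freq n 1) (by norm_num)
  calc energyWt n ^ (-(13 / 5) : ℝ)
      = energyWt n ^ (-(21 / 20) : ℝ) * energyWt n ^ (-(31 / 20) : ℝ) := by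
        rw [← ENNReal.rpow_add _ _ (energyWt_ne_zero hn) (energyWt_ne_top n)]
        norm_num
    _ ≤ max 1 ‖(n 0 : ℝ)‖ₑ ^ (-(21 / 20) : ℝ) *
          (max 1 ‖(n 1 : ℝ)‖ₑ ^ (2 / 3 : ℝ)) ^ (-(31 / 20) : ℝ) :=
        mul_le_mul' (rpow_neg_le_rpow_neg (by norm_num) h0)
          (rpow_neg_le_rpow_neg (by norm_num) h1)
    _ = _ := by
        rw [← ENNReal.rpow_mul]
        norm_num

theorem tsum_max_one_enorm_rpow_neg_ne_top {s : ℝ} (hs : 1 < s) :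
    ∑' a : ℤ, max 1 ‖(a : ℝ)‖ₑ ^ (-s) ≠ ⊤ := by
  have hle (a : ℤ) : max 1 ‖(a : ℝ)‖ₑ ^ (-s) ≤
      ENNReal.ofReal (|(a : ℝ)| ^ (-s)) + if a = 0 then 1 else 0 := by
    by_cases ha : a = 0
    · simp [ha]
    · have ha' : (0 : ℝ) < |(a : ℝ)| := by positivity
      rw [max_eq_right (one_le_enorm_intCast ha), ← ENNReal.ofReal_rpow_of_pos ha',
        Real.enorm_eq_ofReal_abs]
      exact le_self_add
  refine ne_top_of_le_ne_top ?_ (ENNReal.tsum_le_tsum hle)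
  rw [ENNReal.tsum_add, tsum_ite_eq, ← ENNReal.ofReal_tsum_of_nonneg (fun a => by positivity)
    (Real.summable_abs_int_rpow hs)]
  simp

theorem tsum_decayWt_ne_top : ∑' n, decayWt n ≠ ⊤ := by
  set f : ℤ → ℝ≥0∞ := fun a => max 1 ‖(a : ℝ)‖ₑ ^ (-(21 / 20) : ℝ)
  set g : ℤ → ℝ≥0∞ := fun b => max 1 ‖(b : ℝ)‖ₑ ^ (-(31 / 30) : ℝ)
  have hprod : ∑' n : Fin 2 → ℤ, f (n 0) * g (n 1) = (∑' a, f a) * ∑' b, g b :=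
    calc ∑' n : Fin 2 → ℤ, f (n 0) * g (n 1) = ∑' p : ℤ × ℤ, f p.1 * g p.2 :=
          (finTwoArrowEquiv ℤ).tsum_eq fun p : ℤ × ℤ => f p.1 * g p.2
      _ = (∑' a, f a) * ∑' b, g b := by
          rw [ENNReal.tsum_prod (f := fun a b => f a * g b)]
          simp only [ENNReal.tsum_mul_left, ENNReal.tsum_mul_right]
  refine ne_top_of_le_ne_top ?_ (ENNReal.tsum_le_tsum decayWt_le)
  rw [hprod]
  exact ENNReal.mul_ne_top (tsum_max_one_enorm_rpow_neg_ne_top (by norm_num))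
    (tsum_max_one_enorm_rpow_neg_ne_top (by norm_num))

end Weights

section BilinearEstimate

variable {B C F H : (Fin 2 → ℤ) → ℝ≥0∞} {r r₁ r₂ y y₁ y₂ : ℝ≥0∞}

/-- The `L²` norm of `|∂₁|^(1/2) f`. -/
def halfNorm (f : (Fin 2 → ℤ) → ℝ≥0∞) : ℝ≥0∞ := l2Norm (halfWt * f)

/-- The square root of the harmonic energy of a function whose Fourier coefficients have the
absolute values `f`. -/
def energyNorm (f : (Fin 2 → ℤ) → ℝ≥0∞) : ℝ≥0∞ := l2Norm (energyWt * f)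

/-- Vanishing average in `x₁`, in terms of Fourier coefficients. -/
def AvgFree (f : (Fin 2 → ℤ) → ℝ≥0∞) : Prop := ∀ n, n 0 = 0 → f n = 0

theorem AvgFree.mul_left (hC : AvgFree C) (B : (Fin 2 → ℤ) → ℝ≥0∞) : AvgFree (B * C) :=
  fun n hn => by rw [Pi.mul_apply, hC n hn, mul_zero]

theorem AvgFree.l2Norm_le_energyNorm (hB : AvgFree B) : l2Norm B ≤ energyNorm B :=
  l2Norm_mono fun n => by
    by_cases hn : n 0 = 0
    · simp [hB n hn]
    · exact le_mul_of_one_le_left' (one_le_energyWt hn)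

theorem l2Norm_transWt_mul_le_energyNorm (B : (Fin 2 → ℤ) → ℝ≥0∞) :
    l2Norm (transWt * B) ≤ energyNorm B :=
  l2Norm_mono fun n => mul_le_mul_left (transWt_le_energyWt n) (B n)

theorem halfNorm_mono (h : B ≤ C) : halfNorm B ≤ halfNorm C :=
  l2Norm_mono fun n => mul_le_mul_right (h n) (halfWt n)

theorem halfNorm_add_le (B C : (Fin 2 → ℤ) → ℝ≥0∞) :
    halfNorm (B + C) ≤ halfNorm B + halfNorm C := by
  rw [halfNorm, mul_add]
  exact l2Norm_add_le _ _

theorem add_le_rpow_neg_add_mul {x y : ℝ≥0∞} (hx : x ≠ 0) (hx' : x ≠ ⊤) (hy : y ≠ 0)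
    (hy' : y ≠ ⊤) :
    x + y ≤ 2 * (x ^ (-(13 / 5) : ℝ) + y ^ (-(13 / 5) : ℝ)) * (x ^ 2 * y ^ (8 / 5 : ℝ)) := by
  have hmax : max x y ≤
      (x ^ (-(13 / 5) : ℝ) + y ^ (-(13 / 5) : ℝ)) * (x ^ 2 * y ^ (8 / 5 : ℝ)) := by
    have hxsq : x ^ 2 = x ^ (2 : ℝ) := (ENNReal.rpow_two x).symm
    rcases le_total x y with h | h
    · calc max x y = y ^ (-(3 / 5) : ℝ) * y ^ (8 / 5 : ℝ) := by
            rw [max_eq_right h, ← ENNReal.rpow_add _ _ hy hy']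
            norm_num
        _ ≤ x ^ (-(3 / 5) : ℝ) * y ^ (8 / 5 : ℝ) := by
            gcongr ?_ * _
            exact rpow_neg_le_rpow_neg (by norm_num) h
        _ = x ^ (-(13 / 5) : ℝ) * (x ^ 2 * y ^ (8 / 5 : ℝ)) := by
            rw [hxsq, ← mul_assoc, ← ENNReal.rpow_add _ _ hx hx']
            norm_num
        _ ≤ _ := by gcongr; exact le_self_add
    · calc max x y = x ^ (-1 : ℝ) * x ^ 2 := by
            rw [max_eq_left h, hxsq, ← ENNReal.rpow_add _ _ hx hx']
            norm_num
        _ ≤ y ^ (-1 : ℝ) * x ^ 2 := by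
            gcongr ?_ * _
            exact rpow_neg_le_rpow_neg (by norm_num) h
        _ = y ^ (-(13 / 5) : ℝ) * (x ^ 2 * y ^ (8 / 5 : ℝ)) := by
            rw [mul_left_comm, ← ENNReal.rpow_add _ _ hy hy', mul_comm]
            norm_num
        _ ≤ _ := by gcongr; exact le_add_self
  rw [mul_assoc, two_mul]
  exact add_le_add ((le_max_left _ _).trans hmax) ((le_max_right _ _).trans hmax)

theorem halfWt_sq_add_le_decayWt {l m : Fin 2 → ℤ} (hl : l 0 ≠ 0) (hm : m 0 ≠ 0) :
    halfWt (l + m) ^ 2 ≤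
      2 * (decayWt l + decayWt m) * (energyWt l ^ 2 * energyWt m ^ (8 / 5 : ℝ)) :=
  calc halfWt (l + m) ^ 2 ≤ halfWt l ^ 2 + halfWt m ^ 2 := halfWt_sq_add_le l m
    _ ≤ energyWt l + energyWt m := by
        rw [halfWt_sq, halfWt_sq]
        exact add_le_add (enorm_freq_zero_le_energyWt l) (enorm_freq_zero_le_energyWt m)
    _ ≤ _ := by
        rw [decayWt, decayWt, if_neg hl, if_neg hm]
        exact add_le_rpow_neg_add_mul (energyWt_ne_zero hl) (energyWt_ne_top l)
          (energyWt_ne_zero hm) (energyWt_ne_top m)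

theorem tsum_energyWt_rpow_mul_sq_le (C : (Fin 2 → ℤ) → ℝ≥0∞) :
    ∑' n, energyWt n ^ (8 / 5 : ℝ) * C n ^ 2 ≤
      (l2Norm C ^ 2) ^ (1 / 5 : ℝ) * (energyNorm C ^ 2) ^ (4 / 5 : ℝ) := by
  rw [energyNorm, l2Norm_sq, l2Norm_sq]
  refine le_trans (le_of_eq (tsum_congr fun n => ?_))
    (tsum_rpow_mul_rpow_le _ _ (by norm_num) (by norm_num) (by norm_num))
  rw [Pi.mul_apply, mul_pow, ENNReal.mul_rpow_of_nonneg _ _ (by norm_num), mul_left_comm,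
    ← ENNReal.rpow_add_of_nonneg _ _ (by norm_num) (by norm_num), ← ENNReal.rpow_two (energyWt n),
    ← ENNReal.rpow_mul]
  norm_num

theorem halfNorm_conv_sq_le (hB : AvgFree B) (hC : AvgFree C) :
    halfNorm (conv B C) ^ 2 ≤ 4 * (∑' n, decayWt n) *
      (energyNorm B ^ 2 * ((l2Norm C ^ 2) ^ (1 / 5 : ℝ) * (energyNorm C ^ 2) ^ (4 / 5 : ℝ))) := by
  have hpointwise (l m : Fin 2 → ℤ) : (halfWt (l + m) * (B l * C m)) ^ 2 ≤
      (2 * decayWt l + 2 * decayWt m) *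
        ((energyWt * B) l ^ 2 * (energyWt m ^ (8 / 5 : ℝ) * C m ^ 2)) := by
    by_cases hl : l 0 = 0
    · simp [hB l hl]
    by_cases hm : m 0 = 0
    · simp [hC m hm]
    calc (halfWt (l + m) * (B l * C m)) ^ 2 = halfWt (l + m) ^ 2 * (B l * C m) ^ 2 := mul_pow ..
      _ ≤ 2 * (decayWt l + decayWt m) * (energyWt l ^ 2 * energyWt m ^ (8 / 5 : ℝ)) *
            (B l * C m) ^ 2 := by
          gcongr
          exact halfWt_sq_add_le_decayWt hl hm
      _ = _ := by
          rw [Pi.mul_apply]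
          ring
  calc halfNorm (conv B C) ^ 2 = ∑' n, (halfWt n * conv B C n) ^ 2 := l2Norm_sq _
    _ ≤ 2 * (∑' n, 2 * decayWt n) *
          (energyNorm B ^ 2 * ∑' n, energyWt n ^ (8 / 5 : ℝ) * C n ^ 2) := by
        rw [energyNorm, l2Norm_sq]
        exact tsum_sq_mul_conv_le hpointwise
    _ ≤ _ := by
        rw [ENNReal.tsum_mul_left, ← mul_assoc 2 2]
        gcongr
        · norm_num
        · exact tsum_energyWt_rpow_mul_sq_le C

/-- The constant of the bilinear estimate `IsControlled.halfNorm_conv_le`. -/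
def bilConst : ℝ≥0∞ := 4 * (∑' n, decayWt n) + 1

theorem bilConst_ne_top : bilConst ≠ ⊤ :=
  ENNReal.add_ne_top.2 ⟨ENNReal.mul_ne_top (by norm_num) tsum_decayWt_ne_top, ENNReal.one_ne_top⟩

theorem one_le_bilConst : 1 ≤ bilConst := le_add_self

/-- The absolute values `F` of the Fourier coefficients of a real function with vanishing average
in `x₁`, together with bounds on its `L²` and energy norms. The bounds are parametrized by fifth
powers so that the exponents `1/5` and `4/5` of the bilinear estimate become integers. -/
structure IsControlled (r y : ℝ≥0∞) (F : (Fin 2 → ℤ) → ℝ≥0∞) : Prop where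
  neg : ∀ n, F (-n) = F n
  avgFree : AvgFree F
  l2Norm_le : l2Norm F ≤ r ^ 5
  energyNorm_le : energyNorm F ≤ y ^ 5

theorem AvgFree.isControlled (hF : AvgFree F) (hneg : ∀ n, F (-n) = F n)
    (henergy : energyNorm F ≤ r ^ 5) : IsControlled r r F :=
  ⟨hneg, hF, hF.l2Norm_le_energyNorm.trans henergy, henergy⟩

theorem IsControlled.halfNorm_conv_le (hF : IsControlled r₁ y₁ F) (hH : IsControlled r₂ y₂ H) :
    halfNorm (conv F H) ≤ bilConst * (y₁ ^ 5 * r₂ * y₂ ^ 4) := by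
  have hl2 : (l2Norm H ^ 2) ^ (1 / 5 : ℝ) ≤ r₂ ^ 2 :=
    calc (l2Norm H ^ 2) ^ (1 / 5 : ℝ) ≤ ((r₂ ^ 5) ^ 2) ^ (1 / 5 : ℝ) :=
          ENNReal.rpow_le_rpow (pow_le_pow_left' hH.l2Norm_le 2) (by norm_num)
      _ = r₂ ^ 2 := by
          simp only [← ENNReal.rpow_natCast, ← ENNReal.rpow_mul]
          norm_num
  have henergy : (energyNorm H ^ 2) ^ (4 / 5 : ℝ) ≤ y₂ ^ 8 :=
    calc (energyNorm H ^ 2) ^ (4 / 5 : ℝ) ≤ ((y₂ ^ 5) ^ 2) ^ (4 / 5 : ℝ) :=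
          ENNReal.rpow_le_rpow (pow_le_pow_left' hH.energyNorm_le 2) (by norm_num)
      _ = y₂ ^ 8 := by
          simp only [← ENNReal.rpow_natCast, ← ENNReal.rpow_mul]
          norm_num
  rw [← ENNReal.pow_le_pow_left_iff two_ne_zero]
  calc halfNorm (conv F H) ^ 2
      ≤ bilConst * ((y₁ ^ 5) ^ 2 * (r₂ ^ 2 * y₂ ^ 8)) := by
        refine (halfNorm_conv_sq_le hF.avgFree hH.avgFree).trans ?_
        gcongr
        · exact le_self_add
        · exact hF.energyNorm_le
    _ ≤ bilConst ^ 2 * ((y₁ ^ 5) ^ 2 * (r₂ ^ 2 * y₂ ^ 8)) := by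
        gcongr
        exact le_self_pow one_le_bilConst two_ne_zero
    _ = (bilConst * (y₁ ^ 5 * r₂ * y₂ ^ 4)) ^ 2 := by ring

end BilinearEstimate

section EnergyEstimate

variable {A B D E F X a b : (Fin 2 → ℤ) → ℝ≥0∞} {r y : ℝ≥0∞}

theorem l2Pairing_conv_transverse_le (hE : ∀ n, E (-n) = E n) (F B : (Fin 2 → ℤ) → ℝ≥0∞) :
    l2Pairing F (conv (halfWt * transWt * B) E) ≤ energyNorm B * halfNorm (conv F E) := by
  rw [mul_assoc]
  exact (l2Pairing_conv_mul_le hE _ _ _).trans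
    (mul_le_mul_left (l2Norm_transWt_mul_le_energyNorm B) _)

theorem l2Pairing_conv_longitudinal_le (hE : ∀ n, E (-n) = E n) (F B : (Fin 2 → ℤ) → ℝ≥0∞) :
    l2Pairing F (conv (halfWt ^ 2 * B) E) ≤ halfNorm B * halfNorm (conv F E) := by
  rw [sq, mul_assoc]
  exact l2Pairing_conv_mul_le hE _ _ _

/-- The mode-by-mode form of the Euler-Lagrange equation: `A` are the absolute values of the
Fourier coefficients of a weak solution and `X` bounds those of the forcing. The three convolution
terms come from `u R₁∂₂u`, `u R₁∂₁u²` and `R₁∂₂u²`, in this order. -/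
def ModeBound (A X : (Fin 2 → ℤ) → ℝ≥0∞) : Prop :=
  ∀ n, n 0 ≠ 0 → energyWt n ^ 2 * A n ≤
    (conv (halfWt * transWt * A) A + conv (halfWt ^ 2 * conv A A) A
      + halfWt * transWt * conv A A + X) n

theorem ModeBound.energyNorm_sq_le (h : ModeBound A X) (hA : AvgFree A)
    (D : (Fin 2 → ℤ) → ℝ≥0∞) :
    energyNorm (D * A) ^ 2 ≤
      l2Pairing (D * A) (D * conv (halfWt * transWt * A) A)
        + l2Pairing (D * A) (D * conv (halfWt ^ 2 * conv A A) A)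
        + l2Pairing (D * A) (D * (halfWt * transWt * conv A A))
        + l2Pairing (D * A) (D * X) := by
  simp only [← l2Pairing_add_right, ← mul_add]
  rw [energyNorm, l2Norm_sq, l2Pairing]
  gcongr with n
  by_cases hn : n 0 = 0
  · simp [hA n hn]
  · calc (energyWt * (D * A)) n ^ 2 = D n * A n * (D n * (energyWt n ^ 2 * A n)) := by
          simp only [Pi.mul_apply]
          ring
      _ ≤ _ := mul_le_mul_right (mul_le_mul_right (h n hn) _) _

/-- Bounds on the weighted families `a A`, `b A` and `D A` entering the energy estimate for `D A`.
Only the energy `y ^ 5` of `D A` itself is to be thought of as large. -/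
structure IsWeightControlled (D a b : (Fin 2 → ℤ) → ℝ≥0∞) (r y : ℝ≥0∞)
    (A : (Fin 2 → ℤ) → ℝ≥0∞) : Prop where
  leibniz : LeibnizWeight D a b
  base : IsControlled r r A
  left : IsControlled r r (a * A)
  right : IsControlled r r (b * A)
  weighted : IsControlled r y (D * A)
  one_le : 1 ≤ r
  le : r ≤ y

theorem pow_mul_pow_le_of_one_le (hr : 1 ≤ r) (hry : r ≤ y) {i j k l : ℕ} (hjl : j ≤ l)
    (hadd : i + j ≤ k + l) : r ^ i * y ^ j ≤ r ^ k * y ^ l := by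
  rcases le_total i k with h | h
  · exact mul_le_mul' (pow_le_pow_right' hr h) (pow_le_pow_right' (hr.trans hry) hjl)
  · obtain ⟨m, rfl⟩ := Nat.exists_eq_add_of_le h
    calc r ^ (k + m) * y ^ j ≤ r ^ k * (y ^ m * y ^ j) := by
          rw [pow_add, mul_assoc]
          gcongr
      _ ≤ r ^ k * y ^ l := by
          rw [← pow_add]
          gcongr
          · exact hr.trans hry
          · omega

theorem IsControlled.halfNorm_conv_le_pow_ten (hE : IsControlled r r E)
    (hF : IsControlled r r F) : halfNorm (conv E F) ≤ bilConst * r ^ 10 :=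
  (hE.halfNorm_conv_le hF).trans_eq (by ring)

theorem IsControlled.halfNorm_conv_comm_le (hE : IsControlled r r E) (hF : IsControlled r y F) :
    halfNorm (conv F E) ≤ bilConst * (r ^ 6 * y ^ 4) := by
  rw [conv_comm]
  exact (hE.halfNorm_conv_le hF).trans_eq (by ring)

theorem IsControlled.halfNorm_conv_self_le (hF : IsControlled r y F) :
    halfNorm (conv F F) ≤ bilConst * (r * y ^ 9) :=
  (hF.halfNorm_conv_le hF).trans_eq (by ring)

theorem SubadditiveWeight.halfNorm_mul_conv_self_le (ha : SubadditiveWeight a)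
    (hA : IsControlled r r A) (haA : IsControlled r r (a * A)) :
    halfNorm (a * conv A A) ≤ 2 * (bilConst * r ^ 10) :=
  calc halfNorm (a * conv A A) ≤ halfNorm (conv (a * A) A) + halfNorm (conv A (a * A)) :=
        (halfNorm_mono (ha.mul_conv_le A A)).trans (halfNorm_add_le _ _)
    _ ≤ bilConst * r ^ 10 + bilConst * r ^ 10 :=
        add_le_add (haA.halfNorm_conv_le_pow_ten hA) (hA.halfNorm_conv_le_pow_ten haA)
    _ = 2 * (bilConst * r ^ 10) := (two_mul _).symm

namespace IsWeightControlled

theorem bilConst_mul_le (h : IsWeightControlled D a b r y A) {i j : ℕ} (hj : j ≤ 9)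
    (hadd : i + j ≤ 20) : bilConst * (r ^ i * y ^ j) ≤ bilConst ^ 2 * (r ^ 11 * y ^ 9) :=
  mul_le_mul' (le_self_pow one_le_bilConst two_ne_zero)
    (pow_mul_pow_le_of_one_le h.one_le h.le hj hadd)

theorem halfNorm_mul_conv_self_le (h : IsWeightControlled D a b r y A) :
    halfNorm (D * conv A A) ≤ 4 * (bilConst * (r ^ 6 * y ^ 4)) := by
  have hlow : bilConst * r ^ 10 ≤ bilConst * (r ^ 6 * y ^ 4) := by
    gcongr
    simpa using pow_mul_pow_le_of_one_le h.one_le h.le (i := 10) (j := 0) (k := 6) (l := 4)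
      (by norm_num) (by norm_num)
  calc halfNorm (D * conv A A)
      ≤ halfNorm (conv (D * A) A) + halfNorm (conv A (D * A))
        + halfNorm (conv (a * A) (b * A)) + halfNorm (conv (b * A) (a * A)) := by
        refine (halfNorm_mono (h.leibniz.mul_conv_le A A)).trans ?_
        exact (halfNorm_add_le _ _).trans (add_le_add_left ((halfNorm_add_le _ _).trans
          (add_le_add_left (halfNorm_add_le _ _) _)) _)
    _ ≤ bilConst * (r ^ 6 * y ^ 4) + bilConst * (r ^ 6 * y ^ 4)
        + bilConst * (r ^ 6 * y ^ 4) + bilConst * (r ^ 6 * y ^ 4) := by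
        refine add_le_add (add_le_add (add_le_add ?_ ?_) ?_) ?_
        · exact h.base.halfNorm_conv_comm_le h.weighted
        · exact conv_comm A (D * A) ▸ h.base.halfNorm_conv_comm_le h.weighted
        · exact (h.left.halfNorm_conv_le_pow_ten h.right).trans hlow
        · exact (h.right.halfNorm_conv_le_pow_ten h.left).trans hlow
    _ = 4 * (bilConst * (r ^ 6 * y ^ 4)) := by ring

theorem transport_le (h : IsWeightControlled D a b r y A) :
    l2Pairing (D * A) (D * conv (halfWt * transWt * A) A) ≤
      4 * (bilConst ^ 2 * (r ^ 11 * y ^ 9)) := by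
  have hhigh_low : l2Pairing (D * A) (conv (halfWt * transWt * (D * A)) A) ≤
      bilConst ^ 2 * (r ^ 11 * y ^ 9) :=
    calc _ ≤ y ^ 5 * (bilConst * (r ^ 6 * y ^ 4)) :=
          (l2Pairing_conv_transverse_le h.base.neg _ _).trans
            (mul_le_mul' h.weighted.energyNorm_le (h.base.halfNorm_conv_comm_le h.weighted))
      _ = bilConst * (r ^ 6 * y ^ 9) := by ring
      _ ≤ _ := h.bilConst_mul_le (by norm_num) (by norm_num)
  have hlow_high : l2Pairing (D * A) (conv (halfWt * transWt * A) (D * A)) ≤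
      bilConst ^ 2 * (r ^ 11 * y ^ 9) :=
    calc _ ≤ r ^ 5 * (bilConst * (r * y ^ 9)) :=
          (l2Pairing_conv_transverse_le h.weighted.neg _ _).trans
            (mul_le_mul' h.base.energyNorm_le h.weighted.halfNorm_conv_self_le)
      _ = bilConst * (r ^ 6 * y ^ 9) := by ring
      _ ≤ _ := h.bilConst_mul_le (by norm_num) (by norm_num)
  have hmixed {E F : (Fin 2 → ℤ) → ℝ≥0∞} (hE : IsControlled r r E) (hF : IsControlled r r F) :
      l2Pairing (D * A) (conv (halfWt * transWt * E) F) ≤ bilConst ^ 2 * (r ^ 11 * y ^ 9) :=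
    calc _ ≤ r ^ 5 * (bilConst * (r ^ 6 * y ^ 4)) :=
          (l2Pairing_conv_transverse_le hF.neg _ _).trans
            (mul_le_mul' hE.energyNorm_le (hF.halfNorm_conv_comm_le h.weighted))
      _ = bilConst * (r ^ 11 * y ^ 4) := by ring
      _ ≤ _ := h.bilConst_mul_le (by norm_num) (by norm_num)
  refine (h.leibniz.l2Pairing_mul_conv_le _ _ _ _).trans ?_
  refine (add_le_add (add_le_add (add_le_add hhigh_low hlow_high) (hmixed h.left h.right))
    (hmixed h.right h.left)).trans_eq ?_
  ring

theorem cubic_le (h : IsWeightControlled D a b r y A) :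
    l2Pairing (D * A) (D * conv (halfWt ^ 2 * conv A A) A) ≤
      9 * (bilConst ^ 2 * (r ^ 11 * y ^ 9)) := by
  have hmono {i j : ℕ} (hj : j ≤ 9) (hadd : i + j ≤ 20) :
      bilConst ^ 2 * (r ^ i * y ^ j) ≤ bilConst ^ 2 * (r ^ 11 * y ^ 9) :=
    mul_le_mul_right (pow_mul_pow_le_of_one_le h.one_le h.le hj hadd) _
  have hhigh_low : l2Pairing (D * A) (conv (halfWt ^ 2 * (D * conv A A)) A) ≤
      4 * (bilConst ^ 2 * (r ^ 11 * y ^ 9)) :=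
    calc _ ≤ 4 * (bilConst * (r ^ 6 * y ^ 4)) * (bilConst * (r ^ 6 * y ^ 4)) :=
          (l2Pairing_conv_longitudinal_le h.base.neg _ _).trans
            (mul_le_mul' h.halfNorm_mul_conv_self_le (h.base.halfNorm_conv_comm_le h.weighted))
      _ = 4 * (bilConst ^ 2 * (r ^ 12 * y ^ 8)) := by ring
      _ ≤ _ := mul_le_mul_right (hmono (by norm_num) (by norm_num)) _
  have hlow_high : l2Pairing (D * A) (conv (halfWt ^ 2 * conv A A) (D * A)) ≤
      bilConst ^ 2 * (r ^ 11 * y ^ 9) :=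
    calc _ ≤ bilConst * r ^ 10 * (bilConst * (r * y ^ 9)) :=
          (l2Pairing_conv_longitudinal_le h.weighted.neg _ _).trans
            (mul_le_mul' (h.base.halfNorm_conv_le_pow_ten h.base)
              h.weighted.halfNorm_conv_self_le)
      _ = bilConst ^ 2 * (r ^ 11 * y ^ 9) := by ring
  have hmixed {w F : (Fin 2 → ℤ) → ℝ≥0∞} (hw : SubadditiveWeight w)
      (hwA : IsControlled r r (w * A)) (hF : IsControlled r r F) :
      l2Pairing (D * A) (conv (halfWt ^ 2 * (w * conv A A)) F) ≤
        2 * (bilConst ^ 2 * (r ^ 11 * y ^ 9)) :=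
    calc _ ≤ 2 * (bilConst * r ^ 10) * (bilConst * (r ^ 6 * y ^ 4)) :=
          (l2Pairing_conv_longitudinal_le hF.neg _ _).trans
            (mul_le_mul' (hw.halfNorm_mul_conv_self_le h.base hwA)
              (hF.halfNorm_conv_comm_le h.weighted))
      _ = 2 * (bilConst ^ 2 * (r ^ 16 * y ^ 4)) := by ring
      _ ≤ _ := mul_le_mul_right (hmono (by norm_num) (by norm_num)) _
  refine (h.leibniz.l2Pairing_mul_conv_le _ _ _ _).trans ?_
  refine (add_le_add (add_le_add (add_le_add hhigh_low hlow_high)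
    (hmixed h.leibniz.left h.left h.right)) (hmixed h.leibniz.right h.right h.left)).trans_eq ?_
  ring

theorem divergence_le (h : IsWeightControlled D a b r y A) :
    l2Pairing (D * A) (D * (halfWt * transWt * conv A A)) ≤
      4 * (bilConst ^ 2 * (r ^ 11 * y ^ 9)) :=
  calc l2Pairing (D * A) (D * (halfWt * transWt * conv A A))
      = l2Pairing (transWt * (D * A)) (halfWt * (D * conv A A)) := by
        refine tsum_congr fun n => ?_
        simp only [Pi.mul_apply]
        ring
    _ ≤ energyNorm (D * A) * halfNorm (D * conv A A) :=
        (l2Pairing_le _ _).trans (mul_le_mul_left (l2Norm_transWt_mul_le_energyNorm _) _)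
    _ ≤ y ^ 5 * (4 * (bilConst * (r ^ 6 * y ^ 4))) :=
        mul_le_mul' h.weighted.energyNorm_le h.halfNorm_mul_conv_self_le
    _ = 4 * (bilConst * (r ^ 6 * y ^ 9)) := by ring
    _ ≤ _ := mul_le_mul_right (h.bilConst_mul_le (by norm_num) (by norm_num)) _

theorem energyNorm_sq_le (h : IsWeightControlled D a b r y A) (hmode : ModeBound A X) :
    energyNorm (D * A) ^ 2 ≤
      17 * bilConst ^ 2 * (r ^ 11 * y ^ 9) + l2Pairing (D * A) (D * X) := by
  refine (hmode.energyNorm_sq_le h.base.avgFree D).trans ?_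
  gcongr
  refine (add_le_add (add_le_add h.transport_le h.cubic_le) h.divergence_le).trans_eq ?_
  ring

end IsWeightControlled

theorem pow_five_le_of_pow_ten_le {K r y Z : ℝ≥0∞} (hK : 1 ≤ K) (hy0 : y ≠ 0) (hy : y ≠ ⊤)
    (h : y ^ 10 ≤ K * (r ^ 11 * y ^ 9 + y ^ 5 * Z)) : y ^ 5 ≤ (2 * K) ^ 5 * (r ^ 55 + Z) := by
  have hcancel (k : ℕ) {u v : ℝ≥0∞} (huv : y ^ k * u ≤ y ^ k * v) : u ≤ v :=
    (ENNReal.mul_le_mul_iff_right (pow_ne_zero _ hy0) (ENNReal.pow_ne_top hy)).1 huv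
  rcases le_total (y ^ 5 * Z) (r ^ 11 * y ^ 9) with hle | hle
  · have hlin : y ≤ 2 * K * r ^ 11 := hcancel 9 <|
      calc y ^ 9 * y = y ^ 10 := by ring
        _ ≤ K * (r ^ 11 * y ^ 9 + r ^ 11 * y ^ 9) := h.trans (by gcongr)
        _ = y ^ 9 * (2 * K * r ^ 11) := by ring
    calc y ^ 5 ≤ (2 * K * r ^ 11) ^ 5 := by gcongr
      _ = (2 * K) ^ 5 * r ^ 55 := by ring
      _ ≤ (2 * K) ^ 5 * (r ^ 55 + Z) := by gcongr; exact le_self_add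
  · have hlin : y ^ 5 ≤ 2 * K * Z := hcancel 5 <|
      calc y ^ 5 * y ^ 5 = y ^ 10 := by ring
        _ ≤ K * (y ^ 5 * Z + y ^ 5 * Z) := h.trans (by gcongr)
        _ = y ^ 5 * (2 * K * Z) := by ring
    exact hlin.trans (mul_le_mul'
      (le_self_pow (one_le_mul one_le_two hK) (by norm_num)) le_add_self)

/-- The constant of the weighted energy estimate `ModeBound.energyNorm_mul_le`. -/
def energyConst : ℝ≥0∞ := (2 * (17 * bilConst ^ 2)) ^ 5

theorem energyConst_ne_top : energyConst ≠ ⊤ := by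
  have := bilConst_ne_top
  unfold energyConst
  finiteness

theorem one_le_seventeen_mul_bilConst_sq : 1 ≤ 17 * bilConst ^ 2 :=
  one_le_mul (by norm_num) (one_le_pow₀ one_le_bilConst)

theorem one_le_energyConst : 1 ≤ energyConst :=
  one_le_pow₀ (one_le_mul one_le_two one_le_seventeen_mul_bilConst_sq)

theorem ModeBound.energyNorm_mul_le (hmode : ModeBound A X) (hD : LeibnizWeight D a b)
    (hneg : ∀ n, A (-n) = A n) (havg : AvgFree A) {M Z : ℝ≥0∞} (hM : 1 ≤ M)
    (hA : energyNorm A ≤ M) (haA : energyNorm (a * A) ≤ M) (hbA : energyNorm (b * A) ≤ M)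
    (hDA : l2Norm (D * A) ≤ M) (hfin : energyNorm (D * A) ≠ ⊤)
    (hX : l2Pairing (D * A) (D * X) ≤ energyNorm (D * A) * Z) :
    energyNorm (D * A) ≤ energyConst * (M ^ 11 + Z) := by
  have hfifth (x : ℝ≥0∞) : (x ^ (1 / 5 : ℝ)) ^ 5 = x := by
    rw [← ENNReal.rpow_natCast, ← ENNReal.rpow_mul]
    norm_num
  obtain ⟨r, rfl⟩ : ∃ r, r ^ 5 = M := ⟨_, hfifth M⟩
  obtain ⟨y, hy⟩ : ∃ y, y ^ 5 = energyNorm (D * A) := ⟨_, hfifth _⟩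
  have hr : 1 ≤ r := by
    rwa [← ENNReal.pow_le_pow_left_iff (n := 5) (by norm_num), one_pow]
  have hmul_neg {w : (Fin 2 → ℤ) → ℝ≥0∞} (hw : ∀ n, w (-n) = w n) (n : Fin 2 → ℤ) :
      (w * A) (-n) = (w * A) n := by
    simp only [Pi.mul_apply, hw, hneg]
  rcases le_total y r with hyr | hry
  · calc energyNorm (D * A) = y ^ 5 := hy.symm
      _ ≤ r ^ 5 := by gcongr
      _ ≤ (r ^ 5) ^ 11 := le_self_pow hM (by norm_num)
      _ ≤ energyConst * ((r ^ 5) ^ 11 + Z) :=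
        le_self_add.trans (le_mul_of_one_le_left' one_le_energyConst)
  have hcontrolled : IsWeightControlled D a b r y A :=
    { leibniz := hD
      base := havg.isControlled hneg hA
      left := (havg.mul_left a).isControlled (hmul_neg hD.left.neg) haA
      right := (havg.mul_left b).isControlled (hmul_neg hD.right.neg) hbA
      weighted := ⟨hmul_neg hD.neg, havg.mul_left D, hDA, hy.ge⟩
      one_le := hr
      le := hry }
  have hy0 : y ≠ 0 := (zero_lt_one.trans_le (hr.trans hry)).ne'
  have hytop : y ≠ ⊤ := fun htop => hfin (by rw [← hy, htop, ENNReal.top_pow (by norm_num)])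
  rw [← hy, ← pow_mul]
  refine pow_five_le_of_pow_ten_le one_le_seventeen_mul_bilConst_sq hy0 hytop ?_
  calc y ^ 10 = energyNorm (D * A) ^ 2 := by rw [← hy, ← pow_mul]
    _ ≤ 17 * bilConst ^ 2 * (r ^ 11 * y ^ 9) + y ^ 5 * Z :=
      (hcontrolled.energyNorm_sq_le hmode).trans (by rw [hy]; gcongr)
    _ ≤ 17 * bilConst ^ 2 * (r ^ 11 * y ^ 9 + y ^ 5 * Z) := by
      rw [mul_add]
      exact add_le_add le_rfl (le_mul_of_one_le_left' one_le_seventeen_mul_bilConst_sq)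

end EnergyEstimate

section DifferenceQuotients

variable {A X : (Fin 2 → ℤ) → ℝ≥0∞}

/-- The absolute value of the symbol of the difference quotient `Dᵢʰ`. -/
def diffWt (i : Fin 2) (h : ℝ) (n : Fin 2 → ℤ) : ℝ≥0∞ :=
  ‖|h| ^ (-alpha i)‖ₑ * ‖(fourier (n i) (h : UnitAddCircle) : ℂ) - 1‖ₑ

theorem enorm_fourier_apply (k : ℤ) (x : UnitAddCircle) : ‖(fourier k x : ℂ)‖ₑ = 1 := by
  rw [fourier_apply, ← ofReal_norm, Circle.norm_coe, ENNReal.ofReal_one]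

theorem subadditiveWeight_diffWt (i : Fin 2) (h : ℝ) : SubadditiveWeight (diffWt i h) where
  neg n := by
    rw [diffWt, diffWt, Pi.neg_apply, fourier_neg, ← RCLike.enorm_conj (_ - 1 : ℂ), map_sub,
      map_one, Complex.conj_conj]
  add_le l m := by
    simp only [diffWt, Pi.add_apply, fourier_add, ← mul_add]
    set z : ℂ := fourier (l i) (h : UnitAddCircle)
    set w : ℂ := fourier (m i) (h : UnitAddCircle)
    gcongr
    calc ‖z * w - 1‖ₑ = ‖(z - 1) * w + (w - 1)‖ₑ := by ring_nf
      _ ≤ ‖(z - 1) * w‖ₑ + ‖w - 1‖ₑ := enorm_add_le _ _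
      _ = ‖z - 1‖ₑ + ‖w - 1‖ₑ := by rw [enorm_mul, enorm_fourier_apply, mul_one]

theorem enorm_fourier_sub_one_le_two (k : ℤ) (x : UnitAddCircle) :
    ‖(fourier k x : ℂ) - 1‖ₑ ≤ 2 := by
  refine enorm_sub_le.trans ?_
  rw [enorm_fourier_apply, enorm_one, one_add_one_eq_two]

theorem fourier_coe_eq_exp (k : ℤ) (h : ℝ) :
    (fourier k (h : UnitAddCircle) : ℂ) = Complex.exp (Complex.I * (2 * Real.pi * k * h : ℝ)) := by
  rw [fourier_coe_apply]
  push_cast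
  ring_nf

theorem enorm_fourier_sub_one_le_mul (n : Fin 2 → ℤ) (i : Fin 2) (h : ℝ) :
    ‖(fourier (n i) (h : UnitAddCircle) : ℂ) - 1‖ₑ ≤ ‖freq n i‖ₑ * ‖h‖ₑ := by
  rw [fourier_coe_eq_exp, ← enorm_mul]
  exact Real.enorm_exp_I_mul_ofReal_sub_one_le

theorem le_two_mul_rpow_of_le {x y : ℝ≥0∞} {s : ℝ} (hs : s ∈ Set.Icc (0 : ℝ) 1) (hx : x ≤ 2)
    (hxy : x ≤ y) : x ≤ 2 * y ^ s :=
  calc x = x ^ (1 - s) * x ^ s := by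
        rw [← ENNReal.rpow_add_of_nonneg _ _ (by linarith [hs.2]) hs.1, sub_add_cancel,
          ENNReal.rpow_one]
    _ ≤ 2 ^ (1 - s) * y ^ s :=
        mul_le_mul' (ENNReal.rpow_le_rpow hx (by linarith [hs.2])) (ENNReal.rpow_le_rpow hxy hs.1)
    _ ≤ 2 ^ (1 : ℝ) * y ^ s := by
        gcongr ?_ * _
        exact ENNReal.rpow_le_rpow_of_exponent_le one_le_two (by linarith [hs.1])
    _ = 2 * y ^ s := by rw [ENNReal.rpow_one]

theorem enorm_abs_rpow_neg_mul_rpow_le_one (h s : ℝ) : ‖|h| ^ (-s)‖ₑ * ‖h‖ₑ ^ s ≤ 1 := by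
  rcases eq_or_ne h 0 with rfl | hh
  · rcases eq_or_ne s 0 with rfl | hs
    · simp
    · simp [Real.zero_rpow (neg_ne_zero.2 hs)]
  · have habs : 0 < |h| := abs_pos.2 hh
    rw [Real.enorm_eq_ofReal_abs h, ENNReal.ofReal_rpow_of_pos habs, ← Real.enorm_of_nonneg
      (by positivity), ← enorm_mul, ← Real.rpow_add habs]
    simp

theorem diffWt_le_two_mul_energyWt (i : Fin 2) (h : ℝ) {n : Fin 2 → ℤ} (hn : n 0 ≠ 0) :
    diffWt i h n ≤ 2 * energyWt n := by
  have hα := alpha_mem_Icc i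
  calc diffWt i h n ≤ ‖|h| ^ (-alpha i)‖ₑ * (2 * (‖freq n i‖ₑ * ‖h‖ₑ) ^ alpha i) := by
        unfold diffWt
        gcongr
        exact le_two_mul_rpow_of_le hα (enorm_fourier_sub_one_le_two _ _)
          (enorm_fourier_sub_one_le_mul n i h)
    _ = 2 * (‖|h| ^ (-alpha i)‖ₑ * ‖h‖ₑ ^ alpha i) * ‖freq n i‖ₑ ^ alpha i := by
        rw [ENNReal.mul_rpow_of_nonneg _ _ hα.1]
        ring
    _ ≤ 2 * 1 * energyWt n := by
        gcongr
        · exact enorm_abs_rpow_neg_mul_rpow_le_one h _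
        · exact enorm_freq_rpow_alpha_le_energyWt i hn
    _ = 2 * energyWt n := by rw [mul_one]

theorem AvgFree.l2Norm_diffWt_mul_le (hA : AvgFree A) (i : Fin 2) (h : ℝ) :
    l2Norm (diffWt i h * A) ≤ 2 * energyNorm A := by
  calc l2Norm (diffWt i h * A) ≤ l2Norm ((fun _ => 2) * (energyWt * A)) := by
        refine l2Norm_mono fun n => ?_
        by_cases hn : n 0 = 0
        · simp [hA n hn]
        · simpa only [Pi.mul_apply, mul_assoc] using
            mul_le_mul_left (diffWt_le_two_mul_energyWt i h hn) (A n)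
    _ ≤ 2 * energyNorm A := l2Norm_mul_le_of_le fun _ => le_rfl

theorem energyNorm_diffWt_mul_ne_top (hA : energyNorm A ≠ ⊤) (i : Fin 2) (h : ℝ) :
    energyNorm (diffWt i h * A) ≠ ⊤ := by
  have hle : energyNorm (diffWt i h * A) ≤ ‖|h| ^ (-alpha i)‖ₑ * 2 * energyNorm A := by
    rw [energyNorm, mul_left_comm]
    exact l2Norm_mul_le_of_le fun n =>
      mul_le_mul_right (enorm_fourier_sub_one_le_two (n i) h) _
  exact ne_top_of_le_ne_top (by finiteness) hle

theorem ModeBound.energyNorm_diffWt_mul_le (hmode : ModeBound A X) (hneg : ∀ n, A (-n) = A n)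
    (havg : AvgFree A) (hA : energyNorm A ≠ ⊤) (i : Fin 2) (h : ℝ) :
    energyNorm (diffWt i h * A) ≤
      energyConst * ((1 + 2 * energyNorm A) ^ 11 + 2 * l2Norm X) := by
  have hle : energyNorm A ≤ 1 + 2 * energyNorm A :=
    (le_mul_of_one_le_left' one_le_two).trans le_add_self
  have hzero (K : ℝ≥0∞) : energyNorm (0 * A) ≤ K := by simp [energyNorm, l2Norm]
  refine hmode.energyNorm_mul_le (subadditiveWeight_diffWt i h).leibnizWeight hneg havg
    le_self_add hle (hzero _) (hzero _) ((havg.l2Norm_diffWt_mul_le i h).trans le_add_self)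
    (energyNorm_diffWt_mul_ne_top hA i h) ?_
  rw [← l2Pairing_mul_left]
  calc l2Pairing (diffWt i h * (diffWt i h * A)) X
      ≤ l2Norm (diffWt i h * (diffWt i h * A)) * l2Norm X := l2Pairing_le _ _
    _ ≤ 2 * energyNorm (diffWt i h * A) * l2Norm X := by
        gcongr
        exact (havg.mul_left _).l2Norm_diffWt_mul_le i h
    _ = energyNorm (diffWt i h * A) * (2 * l2Norm X) := by ring

/-- The constant of the estimate for first difference quotients. -/
def firstConst : ℝ≥0∞ := energyConst * 3 ^ 12

theorem one_le_firstConst : 1 ≤ firstConst :=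
  one_le_mul one_le_energyConst (by norm_num)

theorem add_add_pow_le (x y z : ℝ≥0∞) (k : ℕ) :
    (x + y + z) ^ k ≤ 3 ^ k * (x ^ k + y ^ k + z ^ k) := by
  have hmax : x + y + z ≤ 3 * max (max x y) z :=
    calc x + y + z ≤ max (max x y) z + max (max x y) z + max (max x y) z := by
          gcongr <;> simp
      _ = 3 * max (max x y) z := by ring
  calc (x + y + z) ^ k ≤ (3 * max (max x y) z) ^ k := by gcongr
    _ = 3 ^ k * max (max (x ^ k) (y ^ k)) (z ^ k) := by
        rw [mul_pow, (pow_left_mono k).map_max, (pow_left_mono k).map_max]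
    _ ≤ _ := by
        gcongr
        exact max_le (max_le (le_self_add.trans le_self_add) (le_add_self.trans le_self_add))
          le_add_self

theorem pow_le_one_add_pow (x : ℝ≥0∞) {j k : ℕ} (h : j ≤ k) : x ^ j ≤ 1 + x ^ k := by
  rcases le_total x 1 with hx | hx
  · exact (pow_le_one₀ zero_le hx).trans le_self_add
  · exact (pow_le_pow_right' hx h).trans le_add_self

theorem one_add_two_mul_pow_eleven_le (x : ℝ≥0∞) : (1 + 2 * x) ^ 11 ≤ 3 ^ 12 * (1 + x ^ 12) :=
  calc (1 + 2 * x) ^ 11 = (1 + x + x) ^ 11 := by ring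
    _ ≤ 3 ^ 11 * (1 ^ 11 + x ^ 11 + x ^ 11) := add_add_pow_le ..
    _ ≤ 3 ^ 11 * (1 ^ 11 + (1 + x ^ 12) + (1 + x ^ 12)) := by
        gcongr <;> exact pow_le_one_add_pow x (by norm_num)
    _ = 3 ^ 12 + 3 ^ 11 * 2 * x ^ 12 := by ring
    _ ≤ 3 ^ 12 + 3 ^ 12 * x ^ 12 := by
        gcongr _ + ?_ * _
        norm_num
    _ = 3 ^ 12 * (1 + x ^ 12) := by ring

theorem ModeBound.energyNorm_diffWt_mul_le_firstConst (hmode : ModeBound A X)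
    (hneg : ∀ n, A (-n) = A n) (havg : AvgFree A) (hA : energyNorm A ≠ ⊤) (i : Fin 2) (h : ℝ) :
    energyNorm (diffWt i h * A) ≤ firstConst * (1 + l2Norm X + energyNorm A ^ 12) :=
  calc energyNorm (diffWt i h * A)
      ≤ energyConst * ((1 + 2 * energyNorm A) ^ 11 + 2 * l2Norm X) :=
        hmode.energyNorm_diffWt_mul_le hneg havg hA i h
    _ ≤ energyConst * (3 ^ 12 * (1 + energyNorm A ^ 12) + 3 ^ 12 * l2Norm X) := by
        gcongr
        · exact one_add_two_mul_pow_eleven_le _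
        · norm_num
    _ = firstConst * (1 + l2Norm X + energyNorm A ^ 12) := by
        rw [firstConst]
        ring

theorem ModeBound.energyNorm_diffWt_mul_diffWt_mul_le (hmode : ModeBound A X)
    (hneg : ∀ n, A (-n) = A n) (havg : AvgFree A) (havgX : AvgFree X) (hA : energyNorm A ≠ ⊤)
    {P : ℝ≥0∞} (hP : firstConst * (1 + energyNorm X + energyNorm A ^ 12) ≤ P)
    (i : Fin 2) (h h' : ℝ) :
    energyNorm (diffWt i h * diffWt i h' * A) ≤
      energyConst * ((2 * P) ^ 11 + 4 * energyNorm X) := by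
  have hfirst (t : ℝ) : energyNorm (diffWt i t * A) ≤ P := by
    refine (hmode.energyNorm_diffWt_mul_le_firstConst hneg havg hA i t).trans (le_trans ?_ hP)
    gcongr
    exact havgX.l2Norm_le_energyNorm
  have hsum : 1 + energyNorm A ^ 12 ≤ P :=
    calc 1 + energyNorm A ^ 12 ≤ 1 + energyNorm X + energyNorm A ^ 12 := by
          gcongr
          exact le_self_add
      _ ≤ P := (le_mul_of_one_le_left' one_le_firstConst).trans hP
  have hbase : energyNorm A ≤ P := by
    simpa using (pow_le_one_add_pow (energyNorm A) (j := 1) (by norm_num)).trans hsum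
  have hdouble : P ≤ 2 * P := le_mul_of_one_le_left' one_le_two
  have hD : l2Norm (diffWt i h * diffWt i h' * A) ≤ 2 * P := by
    rw [mul_assoc]
    exact ((havg.mul_left _).l2Norm_diffWt_mul_le i h).trans (by gcongr; exact hfirst h')
  refine hmode.energyNorm_mul_le
    ((subadditiveWeight_diffWt i h).leibnizWeight_mul (subadditiveWeight_diffWt i h'))
    hneg havg ((le_self_add.trans hsum).trans hdouble) (hbase.trans hdouble)
    ((hfirst h).trans hdouble) ((hfirst h').trans hdouble) hD ?_ ?_
  · rw [mul_assoc]
    exact energyNorm_diffWt_mul_ne_top (energyNorm_diffWt_mul_ne_top hA i h') i h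
  · rw [mul_assoc _ _ X, ← l2Pairing_mul_left]
    calc _ ≤ l2Norm (diffWt i h * (diffWt i h * diffWt i h' * A)) * l2Norm (diffWt i h' * X) :=
          l2Pairing_le _ _
      _ ≤ 2 * energyNorm (diffWt i h * diffWt i h' * A) * (2 * energyNorm X) :=
          mul_le_mul' ((havg.mul_left _).l2Norm_diffWt_mul_le i h) (havgX.l2Norm_diffWt_mul_le i h')
      _ = energyNorm (diffWt i h * diffWt i h' * A) * (4 * energyNorm X) := by ring

/-- The constant of the estimate for second difference quotients. -/
def secondConst : ℝ≥0∞ := energyConst * 3 * (2 * firstConst) ^ 11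

theorem ModeBound.energyNorm_diffWt_mul_diffWt_mul_le_secondConst (hmode : ModeBound A X)
    (hneg : ∀ n, A (-n) = A n) (havg : AvgFree A) (havgX : AvgFree X) (hA : energyNorm A ≠ ⊤)
    (i : Fin 2) (h h' : ℝ) :
    energyNorm (diffWt i h * diffWt i h' * A) ≤
      secondConst * (1 + energyNorm X + energyNorm A ^ 12) ^ 11 := by
  set S := 1 + energyNorm X + energyNorm A ^ 12
  set Q := 2 * (firstConst * S) with hQ
  have hSQ : 2 * S ≤ Q := by
    rw [hQ]
    gcongr
    exact le_mul_of_one_le_left' one_le_firstConst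
  have hX : energyNorm X ≤ S := le_add_self.trans le_self_add
  have hone : 1 ≤ Q :=
    calc 1 ≤ S := le_self_add.trans le_self_add
      _ ≤ 2 * S := le_mul_of_one_le_left' one_le_two
      _ ≤ Q := hSQ
  calc energyNorm (diffWt i h * diffWt i h' * A) ≤ energyConst * (Q ^ 11 + 4 * energyNorm X) :=
        hmode.energyNorm_diffWt_mul_diffWt_mul_le hneg havg havgX hA le_rfl i h h'
    _ ≤ energyConst * (Q ^ 11 + 2 * (2 * S)) := by
        rw [← mul_assoc 2]
        gcongr
        norm_num
    _ ≤ energyConst * (Q ^ 11 + 2 * Q ^ 11) := by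
        gcongr
        exact hSQ.trans (le_self_pow hone (by norm_num))
    _ = secondConst * S ^ 11 := by
        rw [secondConst, hQ]
        ring

theorem firstConst_ne_top : firstConst ≠ ⊤ :=
  ENNReal.mul_ne_top energyConst_ne_top (by norm_num)

theorem secondConst_ne_top : secondConst ≠ ⊤ := by
  have := energyConst_ne_top
  have := firstConst_ne_top
  unfold secondConst
  finiteness

end DifferenceQuotients

section FractionalRegularity

theorem one_le_norm_exp_sub_one {θ : ℝ} (hθ : |θ| ∈ Set.Icc (Real.pi / 2) Real.pi) :
    1 ≤ ‖Complex.exp (Complex.I * θ) - 1‖ := by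
  have hcos : Real.cos θ ≤ 0 := by
    rw [← Real.cos_abs]
    exact Real.cos_nonpos_of_pi_div_two_le_of_le hθ.1 (by linarith [hθ.2, Real.pi_pos])
  have hre := Complex.abs_re_le_norm (Complex.exp (Complex.I * θ) - 1)
  rw [mul_comm, Complex.sub_re, Complex.exp_ofReal_mul_I_re, Complex.one_re] at hre
  rw [mul_comm]
  exact (le_abs.2 (Or.inr (by linarith))).trans hre

theorem two_pow_log_le_abs {k : ℤ} (hk : k ≠ 0) : (2 : ℝ) ^ Nat.log 2 k.natAbs ≤ |(k : ℝ)| := by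
  rw [← Int.cast_abs, ← Nat.cast_natAbs]
  exact_mod_cast Nat.pow_log_le_self 2 (Int.natAbs_ne_zero.2 hk)

theorem abs_lt_two_pow_log_add_one (k : ℤ) : |(k : ℝ)| < 2 ^ (Nat.log 2 k.natAbs + 1) := by
  rw [← Int.cast_abs, ← Nat.cast_natAbs]
  exact_mod_cast Nat.lt_pow_succ_log_self one_lt_two _

/-- The dyadic step size `2^(-J-2)`, for which the difference quotient captures the frequencies
`2^J ≤ |n i| < 2^(J+1)`. -/
def dyadicStep (J : ℕ) : ℝ := 2⁻¹ ^ (J + 2)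

theorem dyadicStep_mem_Ioc (J : ℕ) : dyadicStep J ∈ Set.Ioc (0 : ℝ) 1 :=
  ⟨by unfold dyadicStep; positivity, pow_le_one₀ (by norm_num) (by norm_num)⟩

theorem abs_mul_dyadicStep_log_mem_Icc {k : ℤ} (hk : k ≠ 0) :
    |(k : ℝ)| * dyadicStep (Nat.log 2 k.natAbs) ∈ Set.Icc (1 / 4 : ℝ) (1 / 2) := by
  have hpos := (dyadicStep_mem_Ioc (Nat.log 2 k.natAbs)).1
  have hscale : dyadicStep (Nat.log 2 k.natAbs) * 2 ^ Nat.log 2 k.natAbs = 1 / 4 := by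
    rw [dyadicStep, inv_pow, pow_add]
    field_simp
    norm_num
  have hupper := abs_lt_two_pow_log_add_one k
  rw [pow_succ] at hupper
  constructor
  · nlinarith [two_pow_log_le_abs hk]
  · nlinarith

theorem enorm_freq_rpow_alpha_le_diffWt (i : Fin 2) {n : Fin 2 → ℤ} (hn : n i ≠ 0) :
    ‖freq n i‖ₑ ^ alpha i ≤ 4 * diffWt i (dyadicStep (Nat.log 2 (n i).natAbs)) n := by
  set h := dyadicStep (Nat.log 2 (n i).natAbs)
  have hpos : 0 < h := (dyadicStep_mem_Ioc _).1
  obtain ⟨hlower, hupper⟩ := abs_mul_dyadicStep_log_mem_Icc hn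
  have hα := alpha_mem_Icc i
  have hsymbol : 1 ≤ ‖(fourier (n i) (h : UnitAddCircle) : ℂ) - 1‖ₑ := by
    rw [← ofReal_norm, ENNReal.one_le_ofReal, fourier_coe_eq_exp]
    refine one_le_norm_exp_sub_one ?_
    rw [mul_assoc, abs_mul, abs_of_pos Real.two_pi_pos, abs_mul, abs_of_pos hpos]
    constructor <;> nlinarith [Real.pi_pos]
  have hfreq : |freq n i| ≤ 4 * h⁻¹ := by
    rw [freq, abs_mul, abs_of_pos Real.two_pi_pos, ← div_eq_mul_inv, le_div_iff₀ hpos]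
    nlinarith [Real.pi_le_four]
  have hscale : |freq n i| ^ alpha i ≤ 4 * |h| ^ (-alpha i) :=
    calc |freq n i| ^ alpha i ≤ (4 * h⁻¹) ^ alpha i := by gcongr; exact hα.1
      _ = 4 ^ alpha i * |h| ^ (-alpha i) := by
          rw [Real.mul_rpow (by norm_num) (by positivity), Real.inv_rpow hpos.le,
            abs_of_pos hpos, Real.rpow_neg hpos.le]
      _ ≤ 4 * |h| ^ (-alpha i) := by
          gcongr
          exact Real.rpow_le_self_of_one_le (by norm_num) hα.2
  calc ‖freq n i‖ₑ ^ alpha i = ENNReal.ofReal (|freq n i| ^ alpha i) := by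
        rw [Real.enorm_eq_ofReal_abs, ENNReal.ofReal_rpow_of_nonneg (abs_nonneg _) hα.1]
    _ ≤ 4 * (‖|h| ^ (-alpha i)‖ₑ * 1) := by
        rw [Real.enorm_of_nonneg (by positivity), mul_one, ← ENNReal.ofReal_ofNat 4,
          ← ENNReal.ofReal_mul (by norm_num)]
        exact ENNReal.ofReal_le_ofReal hscale
    _ ≤ 4 * diffWt i h n := by
        unfold diffWt
        gcongr

theorem two_rpow_le_enorm_freq_rpow_alpha (i : Fin 2) {n : Fin 2 → ℤ} (hn : n i ≠ 0) :
    ((2 : ℝ≥0∞) ^ alpha i) ^ Nat.log 2 (n i).natAbs ≤ ‖freq n i‖ₑ ^ alpha i := by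
  rw [← ENNReal.rpow_natCast, ← ENNReal.rpow_mul, mul_comm, ENNReal.rpow_mul, ENNReal.rpow_natCast]
  refine ENNReal.rpow_le_rpow (le_trans ?_ (enorm_intCast_le_enorm_freq n i)) (alpha_mem_Icc i).1
  rw [Real.enorm_eq_ofReal_abs, ← ENNReal.ofReal_ofNat 2, ← ENNReal.ofReal_pow (by norm_num)]
  exact ENNReal.ofReal_le_ofReal (two_pow_log_le_abs hn)

theorem enorm_freq_rpow_le_diffWt_pow_mul_energyWt (i : Fin 2) (j : ℕ) {s : ℝ}
    (hs : s ≤ j + 1) {n : Fin 2 → ℤ} (hn0 : n 0 ≠ 0) (hni : n i ≠ 0) :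
    ‖freq n i‖ₑ ^ (alpha i * s) ≤
      (((2 : ℝ≥0∞) ^ alpha i) ^ (-(j + 1 - s))) ^ Nat.log 2 (n i).natAbs *
        (4 ^ j * (diffWt i (dyadicStep (Nat.log 2 (n i).natAbs)) n ^ j * energyWt n)) := by
  set J := Nat.log 2 (n i).natAbs
  set κ := ‖freq n i‖ₑ ^ alpha i with hκ
  have hα := (alpha_mem_Icc i).1
  have hfreq0 : ‖freq n i‖ₑ ≠ 0 := enorm_ne_zero.2 (freq_eq_zero_iff.not.2 hni)
  have hκ0 : κ ≠ 0 := (ENNReal.rpow_pos (pos_iff_ne_zero.2 hfreq0) enorm_ne_top).ne'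
  have hκtop : κ ≠ ⊤ := ENNReal.rpow_ne_top_of_nonneg hα enorm_ne_top
  have hdecay : κ ^ (-(j + 1 - s)) ≤ (((2 : ℝ≥0∞) ^ alpha i) ^ (-(j + 1 - s))) ^ J := by
    refine (rpow_neg_le_rpow_neg (by linarith)
      (two_rpow_le_enorm_freq_rpow_alpha i hni)).trans_eq ?_
    rw [← ENNReal.rpow_natCast, ← ENNReal.rpow_mul, mul_comm, ENNReal.rpow_mul,
      ENNReal.rpow_natCast]
  calc ‖freq n i‖ₑ ^ (alpha i * s) = κ ^ (-(j + 1 - s)) * (κ ^ j * κ) := by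
        rw [← pow_succ, ← ENNReal.rpow_natCast, ← ENNReal.rpow_add _ _ hκ0 hκtop, hκ,
          ENNReal.rpow_mul]
        push_cast
        ring_nf
    _ ≤ (((2 : ℝ≥0∞) ^ alpha i) ^ (-(j + 1 - s))) ^ J *
          ((4 * diffWt i (dyadicStep J) n) ^ j * energyWt n) := by
        gcongr
        · exact enorm_freq_rpow_alpha_le_diffWt i hni
        · exact enorm_freq_rpow_alpha_le_energyWt i hn0
    _ = _ := by ring

theorem tsum_enorm_freq_rpow_mul_sq_ne_top {A : (Fin 2 → ℤ) → ℝ≥0∞} (havg : AvgFree A)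
    (hA : l2Norm A ≠ ⊤) (i : Fin 2) (j : ℕ) {M : ℝ≥0∞} (hM : M ≠ ⊤)
    (hD : ∀ h ∈ Set.Ioc (0 : ℝ) 1, energyNorm (diffWt i h ^ j * A) ≤ M)
    {s : ℝ} (hs : s ∈ Set.Ico (0 : ℝ) (j + 1)) :
    ∑' n, (‖freq n i‖ₑ ^ (alpha i * s) * A n) ^ 2 ≠ ⊤ := by
  rcases hs.1.eq_or_lt with rfl | hs0
  · simpa [← l2Norm_sq] using hA
  have hα : 0 < alpha i := by fin_cases i <;> norm_num [alpha]
  set q : ℝ≥0∞ := ((2 : ℝ≥0∞) ^ alpha i) ^ (-(j + 1 - s))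
  have hq : q ^ 2 < 1 := by
    rw [← one_pow 2]
    refine ENNReal.pow_lt_pow_left two_ne_zero (ENNReal.rpow_lt_one_of_one_lt_of_neg ?_ ?_)
    · exact ENNReal.one_lt_rpow ENNReal.one_lt_two hα
    · linarith [hs.2]
  have hpointwise (n : Fin 2 → ℤ) : (‖freq n i‖ₑ ^ (alpha i * s) * A n) ^ 2 ≤
      ∑' J, (q ^ 2) ^ J * ((4 ^ j) ^ 2 * (energyWt * (diffWt i (dyadicStep J) ^ j * A)) n ^ 2) := by
    by_cases hn0 : n 0 = 0
    · simp [havg n hn0]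
    by_cases hni : n i = 0
    · rw [freq_eq_zero_iff.2 hni, enorm_zero, ENNReal.zero_rpow_of_pos (mul_pos hα hs0)]
      simp
    refine le_trans ?_ (ENNReal.le_tsum (Nat.log 2 (n i).natAbs))
    refine (pow_le_pow_left' (mul_le_mul_left
      (enorm_freq_rpow_le_diffWt_pow_mul_energyWt i j hs.2.le hn0 hni) (A n)) 2).trans_eq ?_
    simp only [Pi.mul_apply, Pi.pow_apply]
    ring
  refine ne_top_of_le_ne_top ?_ (ENNReal.tsum_le_tsum hpointwise)
  rw [ENNReal.tsum_comm]
  simp only [ENNReal.tsum_mul_left, ← l2Norm_sq]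
  have hgeometric : ∑' J, (q ^ 2) ^ J * ((4 ^ j) ^ 2 * M ^ 2) ≠ ⊤ := by
    rw [ENNReal.tsum_mul_right, ENNReal.tsum_geometric]
    have : (1 - q ^ 2)⁻¹ ≠ ⊤ := ENNReal.inv_ne_top.2 (tsub_pos_iff_lt.2 hq).ne'
    finiteness
  refine ne_top_of_le_ne_top hgeometric (ENNReal.tsum_le_tsum fun J => ?_)
  gcongr
  exact hD _ (dyadicStep_mem_Ioc J)

end FractionalRegularity

section FourierCoefficients

open UnitAddTorus
open scoped ComplexConjugate

theorem enorm_complex_ofReal (x : ℝ) : ‖(x : ℂ)‖ₑ = ‖x‖ₑ := by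
  rw [← ofReal_norm, Complex.norm_real, ofReal_norm]

theorem enorm_complex_I : ‖Complex.I‖ₑ = 1 := by
  rw [← ofReal_norm, Complex.norm_I, ENNReal.ofReal_one]

theorem coeff_eq_integral (f : T2 → ℝ) (n : Fin 2 → ℤ) :
    coeff f n = ∫ x, mFourier (-n) x * (f x : ℂ) ∂leb := rfl

theorem norm_mFourier_apply {d : Type*} [Fintype d] (n : d → ℤ) (x : UnitAddTorus d) :
    ‖mFourier n x‖ = 1 := by
  simp only [mFourier, ContinuousMap.coe_mk, fourier_apply, norm_prod, Circle.norm_coe,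
    Finset.prod_const_one]

theorem mFourier_apply_add {d : Type*} [Fintype d] (n : d → ℤ) (x y : UnitAddTorus d) :
    mFourier n (x + y) = mFourier n x * mFourier n y := by
  simp only [mFourier, ContinuousMap.coe_mk, ← Finset.prod_mul_distrib, Pi.add_apply, fourier_apply,
    smul_add, AddCircle.toCircle_add, Circle.coe_mul]

theorem mFourier_apply_single {d : Type*} [Fintype d] [DecidableEq d] (n : d → ℤ) (i : d)
    (h : UnitAddCircle) : mFourier n (Pi.single i h) = fourier (n i) h := by
  rw [mFourier, ContinuousMap.coe_mk, Fintype.prod_eq_single i, Pi.single_eq_same]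
  intro j hj
  rw [Pi.single_eq_of_ne hj, fourier_eval_zero]

theorem hasSum_conj_mul_mFourierCoeff {f g : T2 → ℂ} (hf : MemLp f 2 leb) (hg : MemLp g 2 leb) :
    HasSum (fun n => conj (mFourierCoeff f n) * mFourierCoeff g n)
      (∫ x, conj (f x) * g x ∂leb) := by
  have hcoeff {f : T2 → ℂ} (hf : MemLp f 2 leb) (n : Fin 2 → ℤ) :
      mFourierCoeff (hf.toLp f) n = mFourierCoeff f n := by
    refine integral_congr_ae ?_
    filter_upwards [hf.coeFn_toLp] with x hx
    rw [hx]
  have hsum := hasSum_prod_mFourierCoeff (hf.toLp f) (hg.toLp g)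
  simp only [hcoeff] at hsum
  convert hsum using 1
  refine integral_congr_ae ?_
  filter_upwards [hf.coeFn_toLp, hg.coeFn_toLp] with x hfx hgx
  rw [hfx, hgx]

/-- The absolute values of the Fourier coefficients. The mode-by-mode estimates only see a function
through these. -/
def enormCoeff (f : T2 → ℝ) (n : Fin 2 → ℤ) : ℝ≥0∞ := ‖coeff f n‖ₑ

theorem coeff_neg (f : T2 → ℝ) (n : Fin 2 → ℤ) : coeff f (-n) = conj (coeff f n) := by
  rw [coeff_eq_integral, coeff_eq_integral, ← integral_conj]
  simp only [map_mul, Complex.conj_ofReal, mFourier_neg, Complex.conj_conj]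

theorem enormCoeff_neg (f : T2 → ℝ) (n : Fin 2 → ℤ) : enormCoeff f (-n) = enormCoeff f n := by
  rw [enormCoeff, coeff_neg, RCLike.enorm_conj, enormCoeff]

theorem l2Norm_enormCoeff {f : T2 → ℝ} (hf : MemLp f 2 leb) :
    l2Norm (enormCoeff f) = eLpNorm f 2 leb := by
  have hsum : HasSum (fun n => ‖coeff f n‖ ^ 2) (∫ x, ‖f x‖ ^ 2 ∂leb) := by
    have h : HasSum (fun n => conj (coeff f n) * coeff f n) (∫ x, conj (f x : ℂ) * f x ∂leb) :=
      hasSum_conj_mul_mFourierCoeff hf.ofReal hf.ofReal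
    simp only [RCLike.conj_mul, Complex.norm_real] at h
    exact_mod_cast h
  refine (ENNReal.pow_right_strictMono two_ne_zero).injective ?_
  rw [l2Norm_sq]
  calc ∑' n, enormCoeff f n ^ 2 = ENNReal.ofReal (∑' n, ‖coeff f n‖ ^ 2) := by
        rw [ENNReal.ofReal_tsum_of_nonneg (fun n => by positivity) hsum.summable]
        simp only [enormCoeff, ENNReal.ofReal_pow (norm_nonneg _), ofReal_norm]
    _ = ENNReal.ofReal (∫ x, ‖f x‖ ^ 2 ∂leb) := by rw [hsum.tsum_eq]
    _ = eLpNorm f 2 leb ^ 2 := by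
        rw [hf.eLpNorm_eq_integral_rpow_norm two_ne_zero ENNReal.ofNat_ne_top,
          ← ENNReal.ofReal_pow (by positivity)]
        simp only [ENNReal.toReal_ofNat, Real.rpow_two]
        rw [← one_div, ← Real.sqrt_eq_rpow, Real.sq_sqrt (by positivity)]

theorem integrable_mFourier_mul {f : T2 → ℝ} (hf : Integrable f leb) (n : Fin 2 → ℤ) :
    Integrable (fun x => mFourier n x * (f x : ℂ)) leb :=
  hf.ofReal.bdd_mul (mFourier n).continuous.aestronglyMeasurable
    (.of_forall fun x => (norm_mFourier_apply n x).le)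

theorem enormCoeff_sq_le {u : T2 → ℝ} (hu : MemLp u 2 leb) :
    enormCoeff (fun x => u x ^ 2) ≤ conv (enormCoeff u) (enormCoeff u) := by
  intro m
  have hmem : MemLp (fun x => mFourier m x * (u x : ℂ)) 2 leb :=
    MemLp.of_le (g := fun x => (u x : ℂ)) hu.ofReal
      ((mFourier m).continuous.aestronglyMeasurable.mul hu.ofReal.1)
      (.of_forall fun x => by rw [norm_mul, norm_mFourier_apply, one_mul])
  have hshift (n : Fin 2 → ℤ) :
      mFourierCoeff (fun x => mFourier m x * (u x : ℂ)) n = coeff u (n - m) := by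
    rw [coeff_eq_integral]
    refine integral_congr_ae (.of_forall fun x => ?_)
    simp only [smul_eq_mul]
    rw [← mul_assoc, ← mFourier_add, neg_sub, neg_add_eq_sub]
  have hsq : ∫ x, conj (mFourier m x * (u x : ℂ)) * (u x : ℂ) ∂leb =
      coeff (fun x => u x ^ 2) m := by
    rw [coeff_eq_integral]
    refine integral_congr_ae (.of_forall fun x => ?_)
    simp only [map_mul, Complex.conj_ofReal, ← mFourier_neg]
    push_cast
    ring
  have hsum := hasSum_conj_mul_mFourierCoeff hmem (g := fun x => (u x : ℂ)) hu.ofReal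
  rw [enormCoeff, ← hsq, ← hsum.tsum_eq]
  refine enorm_tsum_le_tsum_enorm.trans (ENNReal.tsum_le_tsum fun n => le_of_eq ?_)
  rw [hshift, enorm_mul, ← coeff_neg, neg_sub, mul_comm]
  rfl

theorem coeff_translate (f : T2 → ℝ) (y : T2) (n : Fin 2 → ℤ) :
    coeff (fun x => f (x + y)) n = mFourier n y * coeff f n := by
  have hshift (x : T2) : mFourier (-n) x = mFourier n y * mFourier (-n) (x + y) := by
    rw [mFourier_apply_add, mul_left_comm, ← mFourier_add, add_neg_cancel, mFourier_zero,
      ContinuousMap.one_apply, mul_one]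
  rw [coeff_eq_integral, coeff_eq_integral, ← integral_const_mul,
    ← integral_add_right_eq_self (μ := leb)
      (fun x => mFourier n y * (mFourier (-n) x * (f x : ℂ))) y]
  refine integral_congr_ae (.of_forall fun x => ?_)
  simp only
  rw [hshift x, mul_assoc]

theorem integrable_diffQuot {f : T2 → ℝ} (hf : Integrable f leb) (i : Fin 2) (h : ℝ) :
    Integrable (diffQuot i h f) leb :=
  ((hf.comp_add_right _).sub hf).const_mul _

theorem enormCoeff_diffQuot {f : T2 → ℝ} (hf : Integrable f leb) (i : Fin 2) (h : ℝ) :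
    enormCoeff (diffQuot i h f) = diffWt i h * enormCoeff f := by
  ext n
  have hcoeff : coeff (diffQuot i h f) n = ((|h| ^ (-alpha i) : ℝ) : ℂ) *
      ((fourier (n i) (h : UnitAddCircle) - 1) * coeff f n) := by
    rw [sub_mul, one_mul, ← mFourier_apply_single, ← coeff_translate, coeff_eq_integral,
      coeff_eq_integral, coeff_eq_integral, ← integral_sub (integrable_mFourier_mul
        (hf.comp_add_right _) _) (integrable_mFourier_mul hf _), ← integral_const_mul]
    refine integral_congr_ae (.of_forall fun x => ?_)
    simp only [diffQuot]
    push_cast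
    ring
  rw [enormCoeff, hcoeff, enorm_mul, enorm_mul, Pi.mul_apply, diffWt, mul_assoc, enormCoeff,
    enorm_complex_ofReal]

theorem avgFree_enormCoeff {u : T2 → ℝ} (hu : Integrable u leb) (hv : VanishingAvg u) :
    AvgFree (enormCoeff u) := by
  intro n hn
  have hmp := (measurePreserving_finTwoArrow circ).symm
  have hint := (hmp.integrable_comp_emb (MeasurableEquiv.measurableEmbedding _)).2
    (integrable_mFourier_mul hu (-n))
  rw [enormCoeff, enorm_eq_zero, coeff_eq_integral,
    ← hmp.integral_comp' (fun x => mFourier (-n) x * (u x : ℂ))]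
  refine (integral_prod_symm _ hint).trans (integral_eq_zero_of_ae ?_)
  filter_upwards [hv] with y hy
  have hpair (x : UnitAddCircle) :
      (MeasurableEquiv.finTwoArrow (α := UnitAddCircle)).symm (x, y) = ![x, y] := by
    ext i
    fin_cases i <;> rfl
  have hmode (x : UnitAddCircle) : mFourier (-n) ![x, y] = fourier (-n 1) y := by
    simp [mFourier, hn]
  simp only [Function.comp_apply, hpair, hmode, Pi.zero_apply]
  rw [integral_const_mul, integral_complex_ofReal, hy, Complex.ofReal_zero, mul_zero]

theorem l2NormSq_eq_tsum (a : Coeffs) : l2NormSq a = ∑' n, ‖a n‖ₑ ^ 2 := by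
  simp only [l2NormSq, ENNReal.ofReal_pow (norm_nonneg _), ofReal_norm]

theorem enorm_pd (j : Fin 2) (a : Coeffs) (n : Fin 2 → ℤ) :
    ‖pd j a n‖ₑ = ‖freq n j‖ₑ * ‖a n‖ₑ := by
  rw [pd, enorm_mul, enorm_mul, enorm_complex_ofReal, enorm_complex_I, one_mul]

theorem enorm_absPd (j : Fin 2) (s : ℝ) (a : Coeffs) (n : Fin 2 → ℤ) :
    ‖absPd j s a n‖ₑ = ‖|freq n j| ^ s‖ₑ * ‖a n‖ₑ := by
  rw [absPd, enorm_mul, enorm_complex_ofReal]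

theorem harmonicEnergy_eq_energyNorm_sq (w : T2 → ℝ) :
    harmonicEnergy w = energyNorm (enormCoeff w) ^ 2 := by
  rw [harmonicEnergy, l2NormSq_eq_tsum, l2NormSq_eq_tsum, ← ENNReal.tsum_add, energyNorm, l2Norm_sq]
  refine tsum_congr fun n => ?_
  rw [enorm_absPd, enorm_pd, enorm_pd, Pi.mul_apply, mul_pow (energyWt n), energyWt_sq, transWt,
    enorm_mul, enormCoeff]
  ring

theorem harmonicEnergy_diffQuot {u : T2 → ℝ} (hu : Integrable u leb) (i : Fin 2) (h : ℝ) :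
    harmonicEnergy (diffQuot i h u) = energyNorm (diffWt i h * enormCoeff u) ^ 2 := by
  rw [harmonicEnergy_eq_energyNorm_sq, enormCoeff_diffQuot hu]

theorem harmonicEnergy_diffQuot_diffQuot {u : T2 → ℝ} (hu : Integrable u leb) (i : Fin 2)
    (h h' : ℝ) : harmonicEnergy (diffQuot i h (diffQuot i h' u)) =
      energyNorm (diffWt i h * diffWt i h' * enormCoeff u) ^ 2 := by
  rw [harmonicEnergy_diffQuot (integrable_diffQuot hu i h'), enormCoeff_diffQuot hu, mul_assoc]

theorem l2NormSq_absPd {s : ℝ} (hs : 0 ≤ s) (j : Fin 2) (f : T2 → ℝ) :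
    l2NormSq (absPd j s (coeff f)) = ∑' n, (‖freq n j‖ₑ ^ s * enormCoeff f n) ^ 2 := by
  simp only [l2NormSq_eq_tsum, enorm_absPd, enormCoeff,
    Real.enorm_rpow_of_nonneg (abs_nonneg _) hs, Real.enorm_abs]

end FourierCoefficients

section TestingWithTrigonometricMonomials

open UnitAddTorus
open scoped ComplexConjugate

theorem integral_fourier_circ (k : ℤ) :
    ∫ t, (fourier k t : ℂ) ∂circ = if k = 0 then 1 else 0 := by
  split_ifs with h
  · simp [h]
  · exact integral_eq_zero_of_add_right_eq_neg (fourier_add_half_inv_index h one_pos)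

theorem coeff_one (m : Fin 2 → ℤ) : coeff (fun _ => 1) m = if m = 0 then 1 else 0 := by
  have hprod : coeff (fun _ => 1) m = ∫ x, ∏ i, (fourier ((-m) i) (x i) : ℂ) ∂leb := by
    simp only [coeff_eq_integral, Complex.ofReal_one, mul_one]
    rfl
  rw [hprod, integral_fintype_prod_eq_prod fun i (t : UnitAddCircle) => (fourier ((-m) i) t : ℂ)]
  simp only [integral_fourier_circ, Pi.neg_apply, neg_eq_zero, Finset.prod_ite_zero,
    Finset.prod_const_one, Finset.mem_univ, true_implies, funext_iff, Pi.zero_apply]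

/-- The real trigonometric monomial `2 Re (ζ e^{ik·x})`, the test function that extracts the mode
`k = 2πn` of an equation. -/
def trigMono (ζ : ℂ) (n : Fin 2 → ℤ) : T2 → ℝ := fun x => 2 * (ζ * mFourier n x).re

theorem ofReal_trigMono (ζ : ℂ) (n : Fin 2 → ℤ) (x : T2) :
    (trigMono ζ n x : ℂ) = ζ * mFourier n x + conj ζ * mFourier (-n) x := by
  rw [mFourier_neg, ← map_mul, Complex.add_conj, trigMono]

theorem isTest_trigMono (ζ : ℂ) (n : Fin 2 → ℤ) : IsTest (trigMono ζ n) := by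
  have hexp (y : Fin 2 → ℝ) : trigMono ζ n (fun j => (y j : UnitAddCircle)) =
      2 * Complex.reCLM (ζ *
        (Complex.exp (Complex.I * Complex.ofRealCLM (2 * Real.pi * n 0 * y 0)) *
          Complex.exp (Complex.I * Complex.ofRealCLM (2 * Real.pi * n 1 * y 1)))) := by
    simp only [trigMono, mFourier, ContinuousMap.coe_mk, Fin.prod_univ_two, fourier_coe_eq_exp]
    rfl
  simp only [IsTest, hexp]
  fun_prop

theorem projP_trigMono (ζ : ℂ) {n : Fin 2 → ℤ} (hn : n 0 ≠ 0) :
    projP (trigMono ζ n) = trigMono ζ n := by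
  ext x
  have hint (k : ℤ) : Integrable (fun t : UnitAddCircle => (fourier k t : ℂ)) circ :=
    (fourier k).continuous.integrable_of_hasCompactSupport (HasCompactSupport.of_compactSpace _)
  rw [projP, sub_eq_self, ← Complex.ofReal_eq_zero, ← integral_complex_ofReal]
  simp only [ofReal_trigMono, mFourier, ContinuousMap.coe_mk, Fin.prod_univ_two,
    Matrix.cons_val_zero, Matrix.cons_val_one, Pi.neg_apply]
  rw [integral_add (((hint _).mul_const _).const_mul _) (((hint _).mul_const _).const_mul _)]
  simp only [integral_const_mul, integral_mul_const, integral_fourier_circ, neg_eq_zero, hn,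
    if_false, zero_mul, mul_zero, add_zero]

theorem coeff_mul_trigMono {u : T2 → ℝ} (hu : Integrable u leb) (ζ : ℂ) (n m : Fin 2 → ℤ) :
    coeff (fun x => u x * trigMono ζ n x) m =
      ζ * coeff u (m - n) + conj ζ * coeff u (m + n) := by
  simp only [coeff_eq_integral]
  rw [← integral_const_mul, ← integral_const_mul,
    ← integral_add ((integrable_mFourier_mul hu _).const_mul _)
      ((integrable_mFourier_mul hu _).const_mul _)]
  refine integral_congr_ae (.of_forall fun x => ?_)
  simp only [neg_add, sub_eq_add_neg, mFourier_add, neg_neg, Complex.ofReal_mul, ofReal_trigMono]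
  ring

theorem coeff_trigMono (ζ : ℂ) (n m : Fin 2 → ℤ) :
    coeff (trigMono ζ n) m = (if m = n then ζ else 0) + if m = -n then conj ζ else 0 := by
  simpa only [one_mul, coeff_one, sub_eq_zero, add_eq_zero_iff_eq_neg, mul_ite, mul_one, mul_zero]
    using coeff_mul_trigMono (u := fun _ => 1) (integrable_const _) ζ n m

theorem pairing_trigMono (a : Coeffs) (ζ : ℂ) (n : Fin 2 → ℤ) :
    pairing a (trigMono ζ n) = a n * conj ζ + a (-n) * ζ := by
  have hterm (m : Fin 2 → ℤ) : a m * conj (coeff (trigMono ζ n) m) =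
      (if m = n then a n * conj ζ else 0) + if m = -n then a (-n) * ζ else 0 := by
    rw [coeff_trigMono, map_add, mul_add, apply_ite conj, apply_ite conj, map_zero,
      Complex.conj_conj, mul_ite, mul_ite, mul_zero]
    congr 1 <;> exact ite_congr rfl (fun h => by rw [h]) fun _ => rfl
  simp only [pairing, hterm]
  rw [((hasSum_ite_eq n _).add (hasSum_ite_eq (-n) _)).tsum_eq]

theorem enorm_pairing_trigMono_le {a : Coeffs} {B : (Fin 2 → ℤ) → ℝ≥0∞}
    (ha : ∀ m, ‖a m‖ₑ ≤ B m) (hB : ∀ m, B (-m) = B m) {ζ : ℂ} (hζ : ‖ζ‖ₑ = 1) (n : Fin 2 → ℤ) :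
    ‖pairing a (trigMono ζ n)‖ₑ ≤ 2 * B n := by
  rw [pairing_trigMono]
  refine (enorm_add_le _ _).trans ?_
  rw [enorm_mul, enorm_mul, RCLike.enorm_conj, hζ, mul_one, mul_one, two_mul]
  exact add_le_add (ha n) ((ha (-n)).trans_eq (hB n))

theorem enorm_pairing_mul_trigMono_le {a : Coeffs} {B : (Fin 2 → ℤ) → ℝ≥0∞}
    (ha : ∀ m, ‖a m‖ₑ ≤ B m) (hB : ∀ m, B (-m) = B m) {u : T2 → ℝ} (hu : Integrable u leb)
    {ζ : ℂ} (hζ : ‖ζ‖ₑ = 1) (n : Fin 2 → ℤ) :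
    ‖pairing a (fun x => u x * trigMono ζ n x)‖ₑ ≤ 2 * conv B (enormCoeff u) n := by
  have hterm (m : Fin 2 → ℤ) : ‖a m * conj (coeff (fun x => u x * trigMono ζ n x) m)‖ₑ ≤
      B m * enormCoeff u (n - m) + B (-m) * enormCoeff u (n - -m) := by
    rw [enorm_mul, RCLike.enorm_conj, coeff_mul_trigMono hu, hB, ← mul_add]
    refine mul_le_mul' (ha m) ((enorm_add_le _ _).trans_eq ?_)
    rw [enorm_mul, enorm_mul, RCLike.enorm_conj, hζ, one_mul, one_mul, ← enormCoeff_neg u (n - m),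
      neg_sub, sub_neg_eq_add, add_comm n m, enormCoeff, enormCoeff]
  have hneg : ∑' m, B (-m) * enormCoeff u (n - -m) = conv B (enormCoeff u) n :=
    (Equiv.neg (Fin 2 → ℤ)).tsum_eq fun m => B m * enormCoeff u (n - m)
  refine enorm_tsum_le_tsum_enorm.trans ((ENNReal.tsum_le_tsum hterm).trans_eq ?_)
  rw [ENNReal.tsum_add, hneg, two_mul]
  rfl

theorem enorm_sign_freq (n : Fin 2 → ℤ) :
    ‖((SignType.sign (freq n 0) : ℝ) : ℂ)‖ₑ = if n 0 = 0 then 0 else 1 := by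
  simp only [← freq_eq_zero_iff (n := n) (j := 0)]
  rcases lt_trichotomy (freq n 0) 0 with h | h | h
  · simp [sign_neg h, h.ne]
  · simp [h]
  · simp [sign_pos h, h.ne']

theorem enorm_hilbert1_pd_one (a : Coeffs) (n : Fin 2 → ℤ) :
    ‖hilbert1 (pd 1 a) n‖ₑ = halfWt n * transWt n * ‖a n‖ₑ := by
  rw [hilbert1, enorm_mul, enorm_mul, enorm_complex_I, one_mul, enorm_sign_freq, enorm_pd]
  split_ifs with hn
  · simp [halfWt, freq, hn]
  · rw [halfWt_mul_transWt hn, one_mul]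

theorem enorm_hilbert1_pd_zero (a : Coeffs) (n : Fin 2 → ℤ) :
    ‖hilbert1 (pd 0 a) n‖ₑ = halfWt n ^ 2 * ‖a n‖ₑ := by
  rw [hilbert1, enorm_mul, enorm_mul, enorm_complex_I, one_mul, enorm_sign_freq, enorm_pd,
    halfWt_sq]
  split_ifs with hn
  · simp [freq, hn]
  · rw [one_mul]

theorem opL_apply (a : Coeffs) (n : Fin 2 → ℤ) :
    opL a n = ((freq n 0 ^ 2 + |freq n 0| ^ (-1 : ℝ) * freq n 1 ^ 2 : ℝ) : ℂ) * a n := by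
  simp only [opL, pd, absPd, Pi.sub_apply, Pi.neg_apply]
  push_cast
  linear_combination (-(freq n 0 : ℂ) ^ 2 * a n -
    ((|freq n 0| ^ (-1 : ℝ) : ℝ) : ℂ) * (freq n 1 : ℂ) ^ 2 * a n) * Complex.I_mul_I

theorem enorm_symbol_opL (n : Fin 2 → ℤ) :
    ‖freq n 0 ^ 2 + |freq n 0| ^ (-1 : ℝ) * freq n 1 ^ 2‖ₑ = energyWt n ^ 2 := by
  have htrans : |freq n 0| ^ (-1 : ℝ) * freq n 1 ^ 2 =
      (|freq n 0| ^ (-1 / 2 : ℝ) * freq n 1) ^ 2 := by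
    rw [mul_pow, ← Real.rpow_mul_natCast (abs_nonneg _)]
    norm_num
  rw [htrans, energyWt_sq, transWt, Real.enorm_of_nonneg (by positivity),
    ENNReal.ofReal_add (by positivity) (by positivity), ← enorm_pow, ← enorm_pow,
    Real.enorm_of_nonneg (sq_nonneg _), Real.enorm_of_nonneg (sq_nonneg _)]

theorem enorm_pairing_opL_trigMono {u : T2 → ℝ} {ζ : ℂ} {n : Fin 2 → ℤ}
    (hζ : coeff u n * conj ζ = ‖coeff u n‖) :
    ‖pairing (opL (coeff u)) (trigMono ζ n)‖ₑ = 2 * (energyWt n ^ 2 * enormCoeff u n) := by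
  set c : ℝ := freq n 0 ^ 2 + |freq n 0| ^ (-1 : ℝ) * freq n 1 ^ 2 with hc
  have hζ' : conj (coeff u n) * ζ = ‖coeff u n‖ := by
    rw [← Complex.conj_ofReal, ← hζ, map_mul, Complex.conj_conj]
  have hpair : pairing (opL (coeff u)) (trigMono ζ n) = ((2 * (c * ‖coeff u n‖) : ℝ) : ℂ) := by
    rw [pairing_trigMono, opL_apply, opL_apply, coeff_neg, freq_neg, freq_neg, abs_neg, neg_sq,
      neg_sq, mul_assoc, hζ, mul_assoc, hζ', ← two_mul]
    push_cast [hc]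
    rfl
  rw [hpair, enorm_complex_ofReal, enorm_mul, enorm_mul, hc, enorm_symbol_opL, enorm_norm,
    enormCoeff, Real.enorm_of_nonneg zero_le_two, ENNReal.ofReal_ofNat]

theorem enorm_half_mul_le (z : ℂ) : ‖1 / 2 * z‖ₑ ≤ ‖z‖ₑ := by
  rw [← ofReal_norm, ← ofReal_norm]
  refine ENNReal.ofReal_le_ofReal ?_
  rw [norm_mul]
  exact mul_le_of_le_one_left (norm_nonneg z) (by norm_num)

/-- The part of a sequence that is supported in the modes with `k₁ ≠ 0`, that is, the projection
`P` on the level of Fourier coefficients. -/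
def avgFreePart (B : (Fin 2 → ℤ) → ℝ≥0∞) : (Fin 2 → ℤ) → ℝ≥0∞ := {n | n 0 ≠ 0}.indicator B

theorem avgFree_avgFreePart (B : (Fin 2 → ℤ) → ℝ≥0∞) : AvgFree (avgFreePart B) :=
  fun _ hn => Set.indicator_of_notMem (not_not.2 hn) B

theorem avgFreePart_apply (B : (Fin 2 → ℤ) → ℝ≥0∞) {n : Fin 2 → ℤ} (hn : n 0 ≠ 0) :
    avgFreePart B n = B n :=
  Set.indicator_of_mem (s := {m : Fin 2 → ℤ | m 0 ≠ 0}) hn B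

theorem avgFreePart_le (B : (Fin 2 → ℤ) → ℝ≥0∞) : avgFreePart B ≤ B :=
  Set.indicator_le_self _ B

theorem IsWeakSolution.modeBound {ξ u : T2 → ℝ} (h : IsWeakSolution ξ u) (hu : MemLp u 2 leb) :
    ModeBound (enormCoeff u) (avgFreePart (enormCoeff ξ)) := by
  intro n hn
  set A := enormCoeff u
  have hui : Integrable u leb := hu.integrable one_le_two
  have hA (m : Fin 2 → ℤ) : A (-m) = A m := enormCoeff_neg u m
  obtain ⟨c, hc, hcmul⟩ := Complex.exists_norm_eq_mul_self (coeff u n)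
  set ζ := conj c
  have hζ : ‖ζ‖ₑ = 1 := by rw [RCLike.enorm_conj, ← ofReal_norm, hc, ENNReal.ofReal_one]
  have hquad : enormCoeff (fun x => u x ^ 2) ≤ conv A A := enormCoeff_sq_le hu
  have hpd : ‖pairing (hilbert1 (pd 1 (coeff u))) (fun x => u x * trigMono ζ n x)‖ₑ ≤
      2 * conv (halfWt * transWt * A) A n :=
    enorm_pairing_mul_trigMono_le (B := halfWt * transWt * A)
      (fun m => (enorm_hilbert1_pd_one _ m).le)
      (fun m => by simp only [Pi.mul_apply, halfWt_neg, transWt_neg, hA]) hui hζ n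
  have hcubic : ‖pairing (hilbert1 (pd 0 (coeff fun x => u x ^ 2)))
      (fun x => u x * trigMono ζ n x)‖ₑ ≤ 2 * conv (halfWt ^ 2 * conv A A) A n :=
    enorm_pairing_mul_trigMono_le (B := halfWt ^ 2 * conv A A)
      (fun m => (enorm_hilbert1_pd_zero _ m).trans_le (mul_le_mul_right (hquad m) _))
      (fun m => by simp only [Pi.mul_apply, Pi.pow_apply, halfWt_neg, conv_neg hA hA]) hui hζ n
  have hflux : ‖pairing (hilbert1 (pd 1 (coeff fun x => u x ^ 2))) (trigMono ζ n)‖ₑ ≤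
      2 * (halfWt * transWt * conv A A) n :=
    enorm_pairing_trigMono_le (B := halfWt * transWt * conv A A)
      (fun m => (enorm_hilbert1_pd_one _ m).trans_le (mul_le_mul_right (hquad m) _))
      (fun m => by simp only [Pi.mul_apply, halfWt_neg, transWt_neg, conv_neg hA hA]) hζ n
  have hforce : ‖pairing (coeff ξ) (trigMono ζ n)‖ₑ ≤ 2 * enormCoeff ξ n :=
    enorm_pairing_trigMono_le (fun _ => le_rfl) (enormCoeff_neg ξ) hζ n
  have heq := h _ (isTest_trigMono ζ n)
  rw [projP_trigMono ζ hn] at heq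
  refine (ENNReal.mul_le_mul_iff_right two_ne_zero ENNReal.ofNat_ne_top).1 ?_
  rw [← enorm_pairing_opL_trigMono (by rw [hcmul, Complex.conj_conj, mul_comm]), heq]
  simp only [Pi.add_apply, mul_add, avgFreePart_apply _ hn]
  refine (enorm_add_le _ _).trans (add_le_add (enorm_sub_le.trans
    (add_le_add ?_ ((enorm_half_mul_le _).trans hflux))) hforce)
  rw [enorm_neg]
  exact enorm_sub_le.trans (add_le_add hpd ((enorm_half_mul_le _).trans hcubic))

end TestingWithTrigonometricMonomials

section Estimates

variable {ξ u : T2 → ℝ}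

theorem le_ofReal_toReal_add_one {K : ℝ≥0∞} (hK : K ≠ ⊤) :
    K ≤ ENNReal.ofReal (K.toReal + 1) := by
  rw [ENNReal.ofReal_add ENNReal.toReal_nonneg zero_le_one, ENNReal.ofReal_toReal hK]
  exact le_self_add

theorem MemW.avgFree (hu : MemW u) : AvgFree (enormCoeff u) :=
  avgFree_enormCoeff (hu.1.integrable one_le_two) hu.2.1

theorem MemW.energyNorm_ne_top (hu : MemW u) : energyNorm (enormCoeff u) ≠ ⊤ := by
  have hE := hu.2.2.ne
  rw [harmonicEnergy_eq_energyNorm_sq] at hE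
  exact fun htop => hE (by rw [htop, ENNReal.top_pow two_ne_zero])

theorem MemW.l2Norm_ne_top (hu : MemW u) : l2Norm (enormCoeff u) ≠ ⊤ := by
  rw [l2Norm_enormCoeff hu.1]
  exact hu.1.eLpNorm_ne_top

theorem harmonicEnergy_diffQuot_le (hξ : MemLp ξ 2 leb) (hu : MemW u)
    (hw : IsWeakSolution ξ u) (i : Fin 2) (h : ℝ) :
    harmonicEnergy (diffQuot i h u) ≤
      firstConst ^ 2 * 3 ^ 2 * (1 + eLpNorm ξ 2 leb ^ 2 + harmonicEnergy u ^ 12) := by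
  have hX : l2Norm (avgFreePart (enormCoeff ξ)) ≤ eLpNorm ξ 2 leb :=
    (l2Norm_mono (avgFreePart_le _)).trans_eq (l2Norm_enormCoeff hξ)
  rw [harmonicEnergy_diffQuot (hu.1.integrable one_le_two), harmonicEnergy_eq_energyNorm_sq,
    ← pow_mul]
  calc energyNorm (diffWt i h * enormCoeff u) ^ 2
      ≤ (firstConst * (1 + eLpNorm ξ 2 leb + energyNorm (enormCoeff u) ^ 12)) ^ 2 := by
        gcongr
        refine ((hw.modeBound hu.1).energyNorm_diffWt_mul_le_firstConst
          (enormCoeff_neg u) hu.avgFree hu.energyNorm_ne_top i h).trans ?_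
        gcongr
    _ ≤ firstConst ^ 2 * (3 ^ 2 * (1 ^ 2 + eLpNorm ξ 2 leb ^ 2 +
          (energyNorm (enormCoeff u) ^ 12) ^ 2)) := by
        rw [mul_pow]
        gcongr
        exact add_add_pow_le _ _ _ _
    _ = firstConst ^ 2 * 3 ^ 2 * (1 + eLpNorm ξ 2 leb ^ 2 +
          energyNorm (enormCoeff u) ^ (2 * 12)) := by
        rw [one_pow, ← pow_mul, mul_assoc]

theorem harmonicEnergy_diffQuot_diffQuot_le (hu : MemW u) (hw : IsWeakSolution ξ u) (i : Fin 2)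
    (h h' : ℝ) :
    harmonicEnergy (diffQuot i h (diffQuot i h' u)) ≤
      secondConst ^ 2 * 3 ^ 22 * 2 *
        (1 + harmonicEnergy ξ ^ 22 + harmonicEnergy u ^ 132) := by
  set E := energyNorm (enormCoeff u)
  set F := energyNorm (enormCoeff ξ)
  have hX : energyNorm (avgFreePart (enormCoeff ξ)) ≤ F :=
    l2Norm_mono fun n => mul_le_mul_right (avgFreePart_le _ n) (energyWt n)
  rw [harmonicEnergy_diffQuot_diffQuot (hu.1.integrable one_le_two),
    harmonicEnergy_eq_energyNorm_sq u, harmonicEnergy_eq_energyNorm_sq ξ, ← pow_mul, ← pow_mul]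
  calc energyNorm (diffWt i h * diffWt i h' * enormCoeff u) ^ 2
      ≤ (secondConst * (1 + F + E ^ 12) ^ 11) ^ 2 := by
        gcongr
        refine ((hw.modeBound hu.1).energyNorm_diffWt_mul_diffWt_mul_le_secondConst
          (enormCoeff_neg u) hu.avgFree (avgFree_avgFreePart _) hu.energyNorm_ne_top i h h').trans
          ?_
        gcongr
    _ = secondConst ^ 2 * (1 + F + E ^ 12) ^ 22 := by rw [mul_pow, ← pow_mul]
    _ ≤ secondConst ^ 2 * (3 ^ 22 * (1 ^ 22 + F ^ 22 + (E ^ 12) ^ 22)) := by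
        gcongr
        exact add_add_pow_le _ _ _ _
    _ ≤ secondConst ^ 2 * (3 ^ 22 * (1 ^ 22 + (1 + F ^ 44) + (E ^ 12) ^ 22)) := by
        gcongr
        exact pow_le_one_add_pow F (by norm_num)
    _ ≤ secondConst ^ 2 * (3 ^ 22 * (2 * (1 + F ^ 44 + E ^ 264))) := by
        gcongr
        calc 1 ^ 22 + (1 + F ^ 44) + (E ^ 12) ^ 22 = 2 + F ^ 44 + E ^ 264 := by ring
          _ ≤ 2 + F ^ 44 + E ^ 264 + (F ^ 44 + E ^ 264) := le_self_add
          _ = 2 * (1 + F ^ 44 + E ^ 264) := by ring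
    _ = secondConst ^ 2 * 3 ^ 22 * 2 * (1 + F ^ (2 * 22) + E ^ (2 * 132)) := by
        simp only [mul_assoc, Nat.reduceMul]

theorem MemW.l2NormSq_absPd_lt_top (hu : MemW u) (j : ℕ) {M : ℝ≥0∞} (hM : M ≠ ⊤)
    (hD : ∀ i, ∀ h ∈ Set.Ioc (0 : ℝ) 1, energyNorm (diffWt i h ^ j * enormCoeff u) ^ 2 ≤ M)
    {s : ℝ} (hs : s ∈ Set.Ico (0 : ℝ) (j + 1)) (i : Fin 2) :
    l2NormSq (absPd i (alpha i * s) (coeff u)) < ⊤ := by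
  have hroot (h : ℝ) (hh : h ∈ Set.Ioc (0 : ℝ) 1) :
      energyNorm (diffWt i h ^ j * enormCoeff u) ≤ 1 + M :=
    calc energyNorm (diffWt i h ^ j * enormCoeff u)
        ≤ 1 + energyNorm (diffWt i h ^ j * enormCoeff u) ^ 2 := by
          simpa only [pow_one] using
            pow_le_one_add_pow (energyNorm (diffWt i h ^ j * enormCoeff u)) one_le_two
      _ ≤ 1 + M := by gcongr; exact hD i h hh
  rw [l2NormSq_absPd (mul_nonneg (alpha_mem_Icc i).1 hs.1)]
  exact (tsum_enorm_freq_rpow_mul_sq_ne_top hu.avgFree hu.l2Norm_ne_top i j (by finiteness)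
    hroot hs).lt_top

theorem l2NormSq_absPd_lt_top_of_memLp (hξ : MemLp ξ 2 leb) (hu : MemW u)
    (hw : IsWeakSolution ξ u) {s : ℝ} (hs : s ∈ Set.Ico (0 : ℝ) 2) (i : Fin 2) :
    l2NormSq (absPd i (alpha i * s) (coeff u)) < ⊤ := by
  have hξ' := hξ.eLpNorm_ne_top
  have hu' := hu.2.2.ne
  have hK := firstConst_ne_top
  refine hu.l2NormSq_absPd_lt_top 1
    (M := firstConst ^ 2 * 3 ^ 2 * (1 + eLpNorm ξ 2 leb ^ 2 + harmonicEnergy u ^ 12))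
    (by finiteness) (fun j h _ => ?_) (by norm_num at hs ⊢; exact hs) i
  rw [pow_one, ← harmonicEnergy_diffQuot (hu.1.integrable one_le_two)]
  exact harmonicEnergy_diffQuot_le hξ hu hw j h

theorem l2NormSq_absPd_lt_top_of_harmonicEnergy (hξ : harmonicEnergy ξ < ⊤) (hu : MemW u)
    (hw : IsWeakSolution ξ u) {s : ℝ} (hs : s ∈ Set.Ico (0 : ℝ) 3) (i : Fin 2) :
    l2NormSq (absPd i (alpha i * s) (coeff u)) < ⊤ := by
  have hξ' := hξ.ne
  have hu' := hu.2.2.ne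
  have hK := secondConst_ne_top
  refine hu.l2NormSq_absPd_lt_top 2
    (M := secondConst ^ 2 * 3 ^ 22 * 2 * (1 + harmonicEnergy ξ ^ 22 + harmonicEnergy u ^ 132))
    (by finiteness) (fun j h _ => ?_) (by norm_num at hs ⊢; exact hs) i
  rw [sq (diffWt j h), ← harmonicEnergy_diffQuot_diffQuot (hu.1.integrable one_le_two)]
  exact harmonicEnergy_diffQuot_diffQuot_le hu hw j h h

end Estimates

end Ripple

end

theorem mainTheorem12 :
    (∃ C : ℝ, 0 < C ∧ ∀ ξ u : Ripple.T2 → ℝ,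
      MeasureTheory.MemLp ξ 2 Ripple.leb → Ripple.harmonicEnergy ξ < ⊤ →
      Ripple.MemW u → Ripple.IsWeakSolution ξ u →
        (∀ i : Fin 2,
          (⨆ h ∈ Set.Ioc (0 : ℝ) 1, ⨆ h' ∈ Set.Ioc (0 : ℝ) 1,
            Ripple.harmonicEnergy (Ripple.diffQuot i h (Ripple.diffQuot i h' u)))
          ≤ ENNReal.ofReal C *
              (1 + Ripple.harmonicEnergy ξ ^ 22 + Ripple.harmonicEnergy u ^ 132)) ∧
        (∀ s ∈ Set.Ico (0 : ℝ) 3,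
          Ripple.l2NormSq (Ripple.absPd 0 s (Ripple.coeff u)) < ⊤ ∧
          Ripple.l2NormSq (Ripple.absPd 1 (2 / 3 * s) (Ripple.coeff u)) < ⊤)) ∧
    (∃ C : ℝ, 0 < C ∧ ∀ ξ u : Ripple.T2 → ℝ,
      MeasureTheory.MemLp ξ 2 Ripple.leb →
      Ripple.MemW u → Ripple.IsWeakSolution ξ u →
        (∀ i : Fin 2,
          (⨆ h ∈ Set.Ioc (0 : ℝ) 1,
            Ripple.harmonicEnergy (Ripple.diffQuot i h u))
          ≤ ENNReal.ofReal C *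
              (1 + MeasureTheory.eLpNorm ξ 2 Ripple.leb ^ 2
                + Ripple.harmonicEnergy u ^ 12)) ∧
        (∀ s ∈ Set.Ico (0 : ℝ) 2,
          Ripple.l2NormSq (Ripple.absPd 0 s (Ripple.coeff u)) < ⊤ ∧
          Ripple.l2NormSq (Ripple.absPd 1 (2 / 3 * s) (Ripple.coeff u)) < ⊤)) := by
  refine ⟨⟨(Ripple.secondConst ^ 2 * 3 ^ 22 * 2).toReal + 1, by positivity,
    fun ξ u _ hξ hu hw => ⟨fun i => ?_, fun s hs => ⟨?_, ?_⟩⟩⟩,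
    (Ripple.firstConst ^ 2 * 3 ^ 2).toReal + 1, by positivity,
    fun ξ u hξ hu hw => ⟨fun i => ?_, fun s hs => ⟨?_, ?_⟩⟩⟩
  · have hK := Ripple.secondConst_ne_top
    refine iSup₂_le fun h _ => iSup₂_le fun h' _ =>
      (Ripple.harmonicEnergy_diffQuot_diffQuot_le hu hw i h h').trans ?_
    gcongr
    exact Ripple.le_ofReal_toReal_add_one (by finiteness)
  · simpa [Ripple.alpha] using Ripple.l2NormSq_absPd_lt_top_of_harmonicEnergy hξ hu hw hs 0
  · exact Ripple.l2NormSq_absPd_lt_top_of_harmonicEnergy hξ hu hw hs 1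
  · have hK := Ripple.firstConst_ne_top
    refine iSup₂_le fun h _ => (Ripple.harmonicEnergy_diffQuot_le hξ hu hw i h).trans ?_
    gcongr
    exact Ripple.le_ofReal_toReal_add_one (by finiteness)
  · simpa [Ripple.alpha] using Ripple.l2NormSq_absPd_lt_top_of_memLp hξ hu hw hs 0
  · exact Ripple.l2NormSq_absPd_lt_top_of_memLp hξ hu hw hs 1
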